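/- **Setting.** Let $\mathcal M$ be a (finite-dimensional, smooth) Riemannian manifold with a retraction $\mathrm R$ defined on the whole tangent bundle, that is, a smooth map $\mathrm R\colon \mathrm T\mathcal M\to\mathcal M$ such that for all $(x,s)$ the curve $t\mapsto \mathrm R_x(ts)$ passes through $x$ with velocity $s$ at $t=0$. For $f\colon\mathcal M\to\mathbb R$ let $\hat f_x=f\circ \mathrm R_x$ be the pullback of $f$ to the Euclidean space $\mathrm T_x\mathcal M$, with gradient $\nabla\hat f_x$ and Hessian $\nabla^2\hat f_x$. **Assumptions.** $f$ is twice continuously differentiable, $f\ge f_{\mathrm{low}}$ on $\mathcal M$, and there are $\ell,\hat\rho,b>0$ such that for every $x$ with $\|\mathrm{grad} f(x)\|\le\frac12\ell b$ and with $B_x(3b)=\{u\in \mathrm T_x\mathcal M:\|u\|\le 3b\}$: (1) $\nabla\hat f_x$ is $\ell$-Lipschitz on $B_x(3b)$; (2) $\|\nabla^2\hat f_x(s)-\nabla^2\hat f_x(0)\|\le\hat\rho\|s\|$ for all $s\in B_x(3b)$; (3) $\sigma_{\min}(\mathrm D\mathrm R_x(s))\ge\frac12$ for all $s\in B_x(3b)$.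 Moreover, (4) $\hat f_x(s)\le\hat f_x(0)+\langle\nabla\hat f_x(0),s\rangle+\frac{\ell}{2}\|s\|^2$ for all $(x,s)\in \mathrm T\mathcal M$. The tolerance $\epsilon>0$ satisfies $\sqrt{\hat\rho\epsilon}\le\frac12\ell$ and $\epsilon\le b^2\hat\rho$. **Parameters.** $\eta=\frac1{4\ell}$, $\kappa=\frac{\ell}{\sqrt{\hat\rho\epsilon}}$, $\theta=\frac1{4\sqrt\kappa}$, $\gamma=\frac{\sqrt{\hat\rho\epsilon}}4$, $\bar s=\frac1{32}\sqrt{\epsilon/\hat\rho}$ and, for $\chi,c>0$, $\mathscr T=\sqrt\kappa\,\chi c$, $\mathscr E=\sqrt{\epsilon^3/\hat\rho}\;\chi^{-5}c^{-7}$, $\mathscr M=\frac{\epsilon\sqrt\kappa}{\ell}c^{-1}$. **Algorithm.** $\mathtt{TAGD}(x_0)$ starts with $t=0$ and repeats: compute $\mathrm{grad} f(x_t)$; if $\|\mathrm{grad} f(x_t)\|>2\ell\mathscr M$, set $x_{t+1}=\mathrm R_{x_t}(-\eta\,\mathrm{grad} f(x_t))$ and $t\gets t+1$; else if $\|\mathrm{grad}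 f(x_t)\|>\epsilon$, set $x_{t+\mathscr T}=\mathtt{TSS}(x_t)$ and $t\gets t+\mathscr T$; else return $x_t$. $\mathtt{TSS}(x)$ sets $s_0=v_0=0\in \mathrm T_x\mathcal M$ and does the following for $j=0,\dots,\mathscr T-1$. Set $u_j=s_j+(1-\theta_j)v_j$, where $\theta_j=\theta$ if $\|s_j+(1-\theta)v_j\|\le 2b$ and otherwise $\theta_j\in[\theta,1]$ is such that $\|u_j\|=2b$. If $\hat f_x(s_j)<\hat f_x(u_j)+\langle\nabla\hat f_x(u_j),s_j-u_j\rangle-\frac\gamma2\|s_j-u_j\|^2$, return $\mathrm R_x(w)$, where $w=s_j$ if $\|v_j\|\ge\bar s$ and otherwise $w$ is a minimizer of $\hat f_x$ over $\{s_j,\,s_j\pm\bar s\,v_j/\|v_j\|\}$ (ties broken in any way). Else set $s_{j+1}=u_j-\eta\nabla\hat f_x(u_j)$ and $v_{j+1}=s_{j+1}-s_j$, and return $\mathrm R_x(s_{j+1})$ if $\|s_{j+1}\|>b$ or $\|\nabla\hat f_x(s_{j+1})\|\le\epsilon/2$. After the loop, return $\mathrm R_x(s_{\mathscr T})$. **Theorem.**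 There is a universal constant $c_0>0$ such that, for every $c\ge c_0$, under the assumptions above and for every $\chi\ge\log_2(\theta^{-1})$ such that $\mathscr T$ is a positive integer multiple of $4$, the following holds for every $x_0\in\mathcal M$: $\mathtt{TAGD}(x_0)$ terminates and returns a point $x_t$ with $f(x_t)\le f(x_0)$, $\|\mathrm{grad} f(x_t)\|\le\epsilon$ and $$t\;\le\; T_1:=\max\Big\{\frac{f(x_0)-f_{\mathrm{low}}}{\mathscr E},\,1\Big\}\,\mathscr T .$$ The run uses at most $2T_1$ gradient queries (of $f$ or of its pullbacks), at most $3T_1$ function queries, no Hessian queries, and at most $6T_1$ calls to the retraction (counting one for each evaluation of a pullback or of its gradient and one for each computed iterate on $\mathcal M$). -/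

import Mathlib

open Bundle
open scoped Manifold ContDiff

noncomputable section

namespace TAGD

/-! ## Oracle programs

A deterministic algorithm on a set `M` of points with tangent spaces `T x`, which can access the
cost function and the geometry only through queries. There is no Hessian query. -/

/-- A program is a tree of queries. Each constructor but `done` is one query, followed by the rest
of the program as a function of the answer:
* `value x s`: the value at `s` of the pullback of the cost function to `T x`;
* `pullGrad x s`: the gradient at `s` of the pullback of the cost function to `T x`;
* `grad x`: the Riemannian gradient of the cost function at `x`;
* `retract x s`: the point obtained by retracting `s ∈ T x`. -/
inductive Prog (M : Type*) (T : M → Type*) (α : Type*) where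
  | done (a : α)
  | value (x : M) (s : T x) (k : ℝ → Prog M T α)
  | pullGrad (x : M) (s : T x) (k : T x → Prog M T α)
  | grad (x : M) (k : T x → Prog M T α)
  | retract (x : M) (s : T x) (k : M → Prog M T α)

/-- The answers to the queries. -/
structure Oracle (M : Type*) (T : M → Type*) where
  value : (x : M) → T x → ℝ
  pullGrad : (x : M) → T x → T x
  grad : (x : M) → T x
  retract : (x : M) → T x → M

namespace Prog

variable {M : Type*} {T : M → Type*} {α : Type*}

/-- The output of a program. -/
def output (O : Oracle M T) : Prog M T α → α
  | done a => a
  | value x s k => (k (O.value x s)).output O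
  | pullGrad x s k => (k (O.pullGrad x s)).output O
  | grad x k => (k (O.grad x)).output O
  | retract x s k => (k (O.retract x s)).output O

/-- The number of function queries that a run of the program makes. -/
def valueQueries (O : Oracle M T) : Prog M T α → ℕ
  | done _ => 0
  | value x s k => (k (O.value x s)).valueQueries O + 1
  | pullGrad x s k => (k (O.pullGrad x s)).valueQueries O
  | grad x k => (k (O.grad x)).valueQueries O
  | retract x s k => (k (O.retract x s)).valueQueries O

/-- The number of gradient queries (of the pullbacks, or of the function itself, which is the
gradient of the pullback at the origin) that a run of the program makes. -/
def gradQueries (O : Oracle M T) : Prog M T α → ℕ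
  | done _ => 0
  | value x s k => (k (O.value x s)).gradQueries O
  | pullGrad x s k => (k (O.pullGrad x s)).gradQueries O + 1
  | grad x k => (k (O.grad x)).gradQueries O + 1
  | retract x s k => (k (O.retract x s)).gradQueries O

/-- The number of calls to the retraction that a run of the program makes: one for each explicit
call, and one for each evaluation of a pullback or of the gradient of a pullback. -/
def retractCalls (O : Oracle M T) : Prog M T α → ℕ
  | done _ => 0
  | value x s k => (k (O.value x s)).retractCalls O + 1
  | pullGrad x s k => (k (O.pullGrad x s)).retractCalls O + 1
  | grad x k => (k (O.grad x)).retractCalls O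
  | retract x s k => (k (O.retract x s)).retractCalls O + 1

end Prog

/-! ## The algorithm -/

/-- The parameters of the algorithm; `sbar` is the step length of negative curvature
exploitation, `steps` the maximal number of accelerated steps in one tangent space, and
`bigM` the length scale in the threshold `2 ℓ bigM` for gradient steps. -/
structure Params where
  eps : ℝ
  ell : ℝ
  eta : ℝ
  b : ℝ
  theta : ℝ
  gamma : ℝ
  sbar : ℝ
  steps : ℕ
  bigM : ℝ

/-- A rule which picks the index of a smallest one of three numbers (it settles how ties in the
`argmin` are broken). -/
structure ArgminRule where
  sel : (Fin 3 → ℝ) → Fin 3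
  sel_le : ∀ (a : Fin 3 → ℝ) (i : Fin 3), a (sel a) ≤ a i

open Classical in
/-- The momentum parameter `θ_j`: it is `θ` if `‖s + (1 - θ) v‖ ≤ 2b`, and otherwise a number
`θ' ∈ [θ, 1]` with `‖s + (1 - θ') v‖ = 2b` (there is exactly one when `‖s‖ ≤ b`, `b > 0` and
`θ ≤ 1`). -/
def thetaCap {V : Type*} [NormedAddCommGroup V] [InnerProductSpace ℝ V]
    (p : Params) (s v : V) : ℝ :=
  if ‖s + (1 - p.theta) • v‖ ≤ 2 * p.b then p.theta
  else if h : ∃ θ' ∈ Set.Icc p.theta 1, ‖s + (1 - θ') • v‖ = 2 * p.b then h.choose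
  else p.theta

section Algorithm

variable {M : Type*} {T : M → Type*} {α : Type*}
  [∀ x, NormedAddCommGroup (T x)] [∀ x, InnerProductSpace ℝ (T x)]

open Classical in
/-- Negative curvature exploitation at `(x, s, v)`; the resulting tangent vector is handed to
`k`. -/
def nce (p : Params) (r : ArgminRule) (x : M) (s v : T x) (k : T x → Prog M T α) : Prog M T α :=
  if p.sbar ≤ ‖v‖ then k s
  else
    let vdot : T x := (p.sbar / ‖v‖) • v
    .value x s fun f₀ => .value x (s + vdot) fun f₁ => .value x (s - vdot) fun f₂ =>
      k (![s, s + vdot, s - vdot] (r.sel ![f₀, f₁, f₂]))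

open Classical in
/-- The loop of the tangent space steps in `T x`, with at most `n` more iterations to go, from the
current iterate `s` and momentum `v`; the resulting point is handed to `k`. -/
def tssLoop (p : Params) (r : ArgminRule) (x : M) (k : M → Prog M T α) :
    ℕ → T x → T x → Prog M T α
  | 0, s, _ => .retract x s k
  | n + 1, s, v =>
    let u : T x := s + (1 - thetaCap p s v) • v
    .value x s fun fs => .value x u fun fu => .pullGrad x u fun gu =>
      if fs < fu + inner ℝ gu (s - u) - p.gamma / 2 * ‖s - u‖ ^ 2 then
        nce p r x s v fun w => .retract x w k
      else
        let s' : T x := u - p.eta • gu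
        .pullGrad x s' fun gs' =>
          if p.b < ‖s'‖ ∨ ‖gs'‖ ≤ p.eps / 2 then .retract x s' k
          else tssLoop p r x k n s' (s' - s)

/-- Unperturbed tangent space steps in `T x`, from the origin with zero momentum. -/
def tss (p : Params) (r : ArgminRule) (x : M) (k : M → Prog M T α) : Prog M T α :=
  tssLoop p r x k p.steps 0 0

open Classical in
/-- `tagd p r n t x` runs the `while` loop of the algorithm from the point `x` with counter `t`.
It outputs `some (t', x')` if the loop returns `x'` with counter `t'` in its first `n` rounds,
and `none` if it is cut off after `n` rounds without having returned. -/
def tagd (p : Params) (r : ArgminRule) : ℕ → ℕ → M → Prog M T (Option (ℕ × M))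
  | 0, _, _ => .done none
  | n + 1, t, x =>
    .grad x fun g =>
      if 2 * p.ell * p.bigM < ‖g‖ then .retract x (-(p.eta • g)) fun x' => tagd p r n (t + 1) x'
      else if p.eps < ‖g‖ then tss p r x fun x' => tagd p r n (t + p.steps) x'
      else .done (some (t, x))

end Algorithm

/-! ## The geometry -/

section Geometry

variable {E : Type*} [NormedAddCommGroup E] [NormedSpace ℝ E]
  {M : Type*} [TopologicalSpace M] [ChartedSpace E M]

/-- A retraction defined on the whole tangent bundle: a smooth map to the manifold such that, for
every tangent vector `s` at `x`, the curve `t ↦ R (x, t s)` passes through `x` with velocity `s`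
at `t = 0`. -/
structure IsRetraction [IsManifold 𝓘(ℝ, E) ∞ M] (R : TangentBundle 𝓘(ℝ, E) M → M) : Prop where
  contMDiff : ContMDiff 𝓘(ℝ, E).tangent 𝓘(ℝ, E) ∞ R
  map_zero : ∀ x : M, R ⟨x, 0⟩ = x
  velocity : ∀ (x : M) (s : TangentSpace 𝓘(ℝ, E) x),
    (mfderiv 𝓘(ℝ, ℝ) 𝓘(ℝ, E) (fun t : ℝ => R ⟨x, t • s⟩) 0 (1 : ℝ) : E) = s

/-- The pullback `f ∘ R_x` of `f` to the tangent space at `x`. -/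
def pullback (f : M → ℝ) (R : TangentBundle 𝓘(ℝ, E) M → M) (x : M) :
    TangentSpace 𝓘(ℝ, E) x → ℝ :=
  fun s => f (R ⟨x, s⟩)

variable [FiniteDimensional ℝ E] [RiemannianBundle (fun x : M => TangentSpace 𝓘(ℝ, E) x)]

instance completeSpace_tangentSpace (x : M) : CompleteSpace (TangentSpace 𝓘(ℝ, E) x) :=
  haveI : FiniteDimensional ℝ (TangentSpace 𝓘(ℝ, E) x) := inferInstanceAs (FiniteDimensional ℝ E)
  FiniteDimensional.complete ℝ (TangentSpace 𝓘(ℝ, E) x)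

/-- The Riemannian gradient of `f` at `x`: it represents the differential of `f` at `x` with
respect to the Riemannian inner product. -/
def rgrad (f : M → ℝ) (x : M) : TangentSpace 𝓘(ℝ, E) x :=
  (InnerProductSpace.toDual ℝ (TangentSpace 𝓘(ℝ, E) x)).symm
    (mfderiv 𝓘(ℝ, E) 𝓘(ℝ, ℝ) f x : TangentSpace 𝓘(ℝ, E) x →L[ℝ] ℝ)

/-- The gradient of the pullback at `s`, in the Euclidean space that the tangent space at `x` is. -/
def pgrad (f : M → ℝ) (R : TangentBundle 𝓘(ℝ, E) M → M) (x : M) (s : TangentSpace 𝓘(ℝ, E) x) :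
    TangentSpace 𝓘(ℝ, E) x :=
  gradient (pullback f R x) s

/-- The Hessian of the pullback at `s`. -/
def phess (f : M → ℝ) (R : TangentBundle 𝓘(ℝ, E) M → M) (x : M) (s : TangentSpace 𝓘(ℝ, E) x) :
    TangentSpace 𝓘(ℝ, E) x →L[ℝ] TangentSpace 𝓘(ℝ, E) x :=
  fderiv ℝ (pgrad f R x) s

/-- The differential `T_s` at `s` of the retraction `R_x` at `x`. -/
def retractionDeriv (R : TangentBundle 𝓘(ℝ, E) M → M) (x : M) (s : TangentSpace 𝓘(ℝ, E) x) :
    TangentSpace 𝓘(ℝ, E) x →L[ℝ] TangentSpace 𝓘(ℝ, E) (R ⟨x, s⟩) :=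
  mfderiv 𝓘(ℝ, TangentSpace 𝓘(ℝ, E) x) 𝓘(ℝ, E)
    (fun u : TangentSpace 𝓘(ℝ, E) x => R ⟨x, u⟩) s

/-- The assumptions on the cost function and on its pullbacks. The bound `hsigma` says that the
smallest singular value of `T_s` is at least `1/2`. -/
structure PullbackAssumptions (f : M → ℝ) (R : TangentBundle 𝓘(ℝ, E) M → M)
    (flow ell rho b : ℝ) : Prop where
  hlow : ∀ x, flow ≤ f x
  hC2 : ContMDiff 𝓘(ℝ, E) 𝓘(ℝ, ℝ) 2 f
  hgrad : ∀ x : M, ‖rgrad (E := E) f x‖ ≤ 1 / 2 * ell * b →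
    ∀ s s' : TangentSpace 𝓘(ℝ, E) x, ‖s‖ ≤ 3 * b → ‖s'‖ ≤ 3 * b →
      ‖pgrad f R x s - pgrad f R x s'‖ ≤ ell * ‖s - s'‖
  hhess : ∀ x : M, ‖rgrad (E := E) f x‖ ≤ 1 / 2 * ell * b →
    ∀ s : TangentSpace 𝓘(ℝ, E) x, ‖s‖ ≤ 3 * b →
      ‖phess f R x s - phess f R x 0‖ ≤ rho * ‖s‖
  hsigma : ∀ x : M, ‖rgrad (E := E) f x‖ ≤ 1 / 2 * ell * b →
    ∀ s : TangentSpace 𝓘(ℝ, E) x, ‖s‖ ≤ 3 * b →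
      ∀ u : TangentSpace 𝓘(ℝ, E) x, 1 / 2 * ‖u‖ ≤ ‖retractionDeriv R x s u‖
  hquad : ∀ (x : M) (s : TangentSpace 𝓘(ℝ, E) x),
    pullback f R x s ≤ pullback f R x 0 + inner ℝ (pgrad f R x 0) s + ell / 2 * ‖s‖ ^ 2

/-- The oracle of the problem of minimizing `f` with the retraction `R`. -/
def problemOracle (f : M → ℝ) (R : TangentBundle 𝓘(ℝ, E) M → M) :
    Oracle M (fun x => TangentSpace 𝓘(ℝ, E) x) where
  value := pullback f R
  pullGrad := pgrad f R
  grad := rgrad f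
  retract x s := R ⟨x, s⟩

end Geometry

/-! ## The choice of the parameters -/

/-- `κ = ℓ / √(ρ ε)` -/
def kappa (ell rho eps : ℝ) : ℝ := ell / √(rho * eps)

/-- `θ = 1 / (4 √κ)` -/
def theta (ell rho eps : ℝ) : ℝ := 1 / (4 * √(kappa ell rho eps))

/-- `ℰ = √(ε³ / ρ) χ⁻⁵ c⁻⁷` -/
def bigE (rho eps χ c : ℝ) : ℝ := √(eps ^ 3 / rho) * (χ ^ 5)⁻¹ * (c ^ 7)⁻¹

/-- The parameters of the algorithm: `η = 1 / (4ℓ)`, `γ = √(ρ ε) / 4`, `s = √(ε / ρ) / 32`,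
`ℳ = ε √κ / (ℓ c)`; the number `steps` stands for `√κ χ c`. -/
def params (ell rho b eps c : ℝ) (steps : ℕ) : Params where
  eps := eps
  ell := ell
  eta := 1 / (4 * ell)
  b := b
  theta := theta ell rho eps
  gamma := √(rho * eps) / 4
  sbar := 1 / 32 * √(eps / rho)
  steps := steps
  bigM := eps * √(kappa ell rho eps) / ell * c⁻¹

end TAGD

end

namespace TAGD

/-! ## Scalar gradient descent with momentum -/

/-! Every round that does not return lowers `f` by at least `Δ = 2ℰ`, except possibly the last such
round. So if `N` is the number of times that `Δ` fits in `f(x₀) - f_low`, there are at most `N + 1`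
non-returning rounds. Since `Δ` is twice `ℰ`, the bound `T₁` is at least `max (2N) 1` times the
number of steps per tangent space, which absorbs the extra round.

For a gradient step the decrease is the usual descent inequality. In a tangent space, the
Hamiltonian `F(s) + 2ℓ‖v‖²` drops by `ℓθ‖v'‖²` at every accelerated step that detects no negative
curvature (`energy_stepPair_le`). By Cauchy-Schwarz, either it has dropped by `Δ` or the whole path
is very short compared with `r = √(ε/ρ)` (`pathLength_le`). Leaving the ball of radius `b` therefore
forces a decrease (`le_of_lt_norm_iterate`). So does negative curvature: either the kinetic energy
is already large, or a step of length `r/32` along `±v` profits from the curvature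
(`le_of_negCurv`).

The remaining case is a long run that stays near the origin. There the pullback is almost the
quadratic function with Hessian `H 0`, and the iteration is linear momentum descent with gradient
errors of small total variation. In an eigenbasis of `H 0` it splits into scalar recursions. At
large positive curvature the derivative contracts; at large negative curvature it is controlled by
its values at both ends of the run and decays towards the middle; at small curvature it is close to
an average of gradients, which telescopes (`MomentumRec.abs_deriv_le`). Evaluated in the middle of
the first half of the run, this gives a gradient of norm at most `ε/2` (`norm_grad_le`).

Hence, as long as no gradient of norm at most `ε/2` appears in the first half, the Hamiltonian has
lost `Δ` by then and never regains it (`energy_half_le`). If such a gradient does appear in the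
first half, the singular value bound turns it into a Riemannian gradient of norm at most `ε`
(`norm_rgrad_le`), and the algorithm returns in the next round. -/

/-- One coordinate of gradient descent with momentum, for a quadratic function with derivative
`a + lam s`, with gradient errors `e`. -/
structure MomentumRec (eta th lam a : ℝ) (q : ℕ) (s v e : ℕ → ℝ) : Prop where
  s_zero : s 0 = 0
  v_zero : v 0 = 0
  e_zero : e 0 = 0
  v_succ : ∀ j < q, v (j + 1) =
    (1 - th) * v j - eta * (a + lam * (s j + (1 - th) * v j) + e j)
  s_succ : ∀ j < q, s (j + 1) = s j + v (j + 1)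

lemma abs_sub_le_variation (x : ℕ → ℝ) {i q : ℕ} (hi : i ≤ q) :
    |x i - x 0| ≤ ∑ j ∈ Finset.range q, |x (j + 1) - x j| := by
  rw [← Finset.sum_range_sub]
  exact (Finset.abs_sum_le_sum_abs _ _).trans
    (Finset.sum_le_sum_of_subset_of_nonneg (by simpa using hi) fun _ _ _ => abs_nonneg _)

/-- A discrete maximum principle. -/
lemma discrete_max_principle {a b : ℝ} (hb : 0 ≤ b) (hab : 1 + b < a) {q : ℕ} {d : ℕ → ℝ}
    (h0 : d 0 ≤ 0) (hq : d q ≤ 0)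
    (hd : ∀ j, j + 1 < q → a * d (j + 1) ≤ d (j + 2) + b * d j) :
    ∀ j ≤ q, d j ≤ 0 := by
  -- At an interior maximum with positive value the inequality would give `a d ≤ (1 + b) d`, against
  -- `1 + b < a`.
  obtain ⟨m, hm, hmax⟩ := Finset.exists_max_image (Finset.range (q + 1)) d ⟨0, by simp⟩
  have hle : ∀ j ≤ q, d j ≤ d m := fun j hj => hmax j (by simpa [Nat.lt_succ_iff] using hj)
  suffices hdm : d m ≤ 0 from fun j hj => (hle j hj).trans hdm
  have hmq : m ≤ q := by simpa [Nat.lt_succ_iff] using hm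
  by_contra! hpos
  obtain _ | i := m
  · linarith
  · have hne : i + 1 ≠ q := by rintro rfl; linarith
    have hlt : i + 1 < q := lt_of_le_of_ne hmq hne
    have h1 := hd i hlt
    have h2 := hle (i + 2) (by omega)
    have h3 := mul_le_mul_of_nonneg_left (hle i (by omega)) hb
    nlinarith

namespace MomentumRec

variable {eta th lam a : ℝ} {q : ℕ} {s v e : ℕ → ℝ}

lemma s_eq_sum (h : MomentumRec eta th lam a q s v e) {i : ℕ} (hi : i ≤ q) :
    s i = ∑ j ∈ Finset.range i, v (j + 1) := by
  induction i with
  | zero => simpa using h.s_zero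
  | succ i ih => rw [Finset.sum_range_succ, h.s_succ i (by omega), ih (by omega)]

lemma abs_s_sub_le (h : MomentumRec eta th lam a q s v e) {i k : ℕ} (hi : i ≤ q) (hk : k ≤ q) :
    |s i - s k| ≤ ∑ j ∈ Finset.range q, |v (j + 1)| := by
  wlog hik : k ≤ i generalizing i k
  · rw [abs_sub_comm]
    exact this hk hi (by omega)
  rw [h.s_eq_sum hi, h.s_eq_sum hk, ← Finset.sum_sdiff (Finset.range_subset_range.2 hik),
    add_sub_cancel_right]
  exact (Finset.abs_sum_le_sum_abs _ _).trans
    (Finset.sum_le_sum_of_subset_of_nonneg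
      (Finset.sdiff_subset.trans (Finset.range_subset_range.2 hi)) fun _ _ _ => abs_nonneg _)

lemma abs_v_le (h : MomentumRec eta th lam a q s v e) {i : ℕ} (hi : i ≤ q) :
    |v i| ≤ ∑ j ∈ Finset.range q, |v (j + 1)| := by
  obtain _ | i := i
  · rw [h.v_zero, abs_zero]
    exact Finset.sum_nonneg fun _ _ => abs_nonneg _
  · exact Finset.single_le_sum (f := fun j => |v (j + 1)|) (fun _ _ => abs_nonneg _)
      (Finset.mem_range.2 (by omega))

lemma abs_e_le (h : MomentumRec eta th lam a q s v e) {i : ℕ} (hi : i ≤ q) :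
    |e i| ≤ ∑ j ∈ Finset.range q, |e (j + 1) - e j| := by
  simpa [h.e_zero] using abs_sub_le_variation e hi

/-- Directions of positive curvature: the derivative contracts, because the characteristic
polynomial of the recursion has complex roots. -/
lemma abs_deriv_le_of_pos (h : MomentumRec eta th lam a q s v e) (hth : 0 < th)
    (hth' : th ≤ 1 / 4) (hlam : 4 * th ^ 2 < eta * lam) (hlam' : eta * lam ≤ 1 / 4) {k : ℕ}
    (hk : k ≤ q) :
    |a + lam * s k| ≤ 2 * (1 - th / 2) ^ k * |a|
      + 3 * ∑ j ∈ Finset.range q, |e (j + 1) - e j| := by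
  set t := eta * lam with ht
  set α := (1 - t) * (2 - th) with hα
  set β := (1 - t) * (1 - th) with hβ
  have hthsq : th ^ 2 ≤ 1 / 16 := by nlinarith
  have hth2 : 0 < th ^ 2 := by positivity
  have hβpos : 1 / 2 ≤ β := by nlinarith
  -- The roots of `X² - αX + β` are `α/2 ± iw` with `w² = β - α²/4`. This lower bound on `w`
  -- separates the roots; it is used below as `‖μ‖ ‖1 - μ‖ ≤ 2w`.
  have hdisc : β * t / 4 ≤ β - α ^ 2 / 4 := by
    have : 0 ≤ (1 - t) * (4 * (1 - th) * (1 - t / 4) - (1 - t) * (2 - th) ^ 2) := by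
      apply mul_nonneg (by linarith)
      have : 4 * (1 - th) * (1 - t / 4) - (1 - t) * (2 - th) ^ 2
        = t * (3 - 3 * th + th ^ 2) - th ^ 2 := by ring
      rw [this]
      nlinarith
    have h2 : β - α ^ 2 / 4 - β * t / 4
      = (1 - t) * (4 * (1 - th) * (1 - t / 4) - (1 - t) * (2 - th) ^ 2) / 4 := by
      rw [hα, hβ]; ring
    linarith
  have htpos : 0 < t := by linarith
  have hdpos : 0 < β - α ^ 2 / 4 := lt_of_lt_of_le (by positivity) hdisc
  set w := √(β - α ^ 2 / 4) with hw
  have hwsq : w ^ 2 = β - α ^ 2 / 4 := Real.sq_sqrt hdpos.le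
  set μ : ℂ := ⟨α / 2, w⟩ with hμ
  set μc : ℂ := ⟨α / 2, -w⟩ with hμc
  have hnμ : ‖μ‖ ^ 2 = β := by
    rw [Complex.sq_norm, Complex.normSq_mk]
    linear_combination hwsq
  have hnμc : ‖μc‖ = ‖μ‖ := by
    rw [← sq_eq_sq₀ (norm_nonneg _) (norm_nonneg _), Complex.sq_norm, Complex.sq_norm,
      Complex.normSq_mk, Complex.normSq_mk]
    ring
  have hn1 : ‖1 - μ‖ ^ 2 = t := by
    rw [Complex.sq_norm, Complex.normSq_apply]
    simp only [hμ, Complex.sub_re, Complex.one_re, Complex.sub_im, Complex.one_im]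
    rw [hα, hβ] at hwsq
    rw [hα]
    linear_combination hwsq
  have hμle : ‖μ‖ ≤ 1 - th / 2 := by
    apply le_of_sq_le_sq _ (by linarith)
    rw [hnμ, hβ]
    nlinarith
  have hμ1 : ‖μ‖ ≤ 1 := by linarith
  -- With `D j = a + lam * s j`, this is `(D j + e j) - μ (D (j-1) + e j)`: one characteristic root
  -- is divided out, so that the other one drives `P`. Since `1 - α + β = t`, adding `e j` to both
  -- derivatives removes the constant part of the error, and only its increments enter the
  -- recursion.
  set P : ℕ → ℂ := fun j => ((a + lam * s j + e j : ℝ) : ℂ)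
    - μ * ((a + lam * s j - lam * v j + e j : ℝ) : ℂ) with hP
  have hstep : ∀ j < q, P (j + 1) = μc * P j + (1 - μ) * ((e (j + 1) - e j : ℝ) : ℂ) := by
    intro j hj
    have e1 := h.s_succ j hj
    have e2 := h.v_succ j hj
    have key : (a + lam * s (j + 1) + e j) - α * (a + lam * s j + e j)
        + β * (a + lam * s j - lam * v j + e j) = 0 := by
      rw [e1, e2, hα, hβ, ht]
      ring
    have key2 : a + lam * s (j + 1) - lam * v (j + 1) = a + lam * s j := by
      rw [e1]; ring
    rw [hP]
    dsimp only
    rw [key2]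
    apply Complex.ext
    · simp only [Complex.sub_re, Complex.mul_re, Complex.ofReal_re, Complex.ofReal_im,
        Complex.add_re, Complex.one_re, Complex.sub_im, Complex.mul_im, Complex.one_im, hμ, hμc]
      linear_combination key + (a + lam * s j - lam * v j + e j) * hwsq
    · simp only [Complex.sub_re, Complex.mul_re, Complex.ofReal_re, Complex.ofReal_im,
        Complex.add_im, Complex.one_re, Complex.sub_im, Complex.mul_im, Complex.one_im, hμ, hμc]
      ring
  have hbound : ∀ j ≤ q, ‖P j‖ ≤ ‖1 - μ‖ *
      (‖μ‖ ^ j * |a| + ∑ i ∈ Finset.range j, |e (i + 1) - e i|) := by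
    intro j
    induction j with
    | zero =>
      intro _
      have : P 0 = (1 - μ) * (a : ℂ) := by
        simp only [hP, h.s_zero, h.v_zero, h.e_zero]
        push_cast
        ring
      rw [this, norm_mul, Complex.norm_real]
      simp
    | succ j ih =>
      intro hj
      rw [hstep j (by omega), Finset.sum_range_succ]
      refine (norm_add_le _ _).trans ?_
      rw [norm_mul, norm_mul, Complex.norm_real, hnμc, Real.norm_eq_abs]
      have h1 := mul_le_mul_of_nonneg_left (ih (by omega)) (norm_nonneg μ)
      have h2 : ‖μ‖ * (‖1 - μ‖ * ∑ i ∈ Finset.range j, |e (i + 1) - e i|)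
          ≤ 1 * (‖1 - μ‖ * ∑ i ∈ Finset.range j, |e (i + 1) - e i|) :=
        mul_le_mul_of_nonneg_right hμ1 (mul_nonneg (norm_nonneg _)
          (Finset.sum_nonneg fun _ _ => abs_nonneg _))
      rw [pow_succ]
      linarith
  set x := a + lam * s k + e k with hx
  have hwpos : 0 < w := Real.sqrt_pos.2 hdpos
  -- The previous derivative enters `μc * P k` with the real coefficient `-β`, so the imaginary part
  -- isolates the current one.
  have hmodes : w * |x| ≤ ‖μ‖ * ‖P k‖ := by
    have : (μc * P k).im = -(w * x) := by
      simp only [hP, Complex.sub_re, Complex.mul_re, Complex.ofReal_re, Complex.ofReal_im,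
        Complex.sub_im, Complex.mul_im, hμ, hμc]
      ring
    calc w * |x| = |(μc * P k).im| := by
          rw [this, abs_neg, abs_mul, abs_of_pos hwpos]
      _ ≤ ‖μc * P k‖ := Complex.abs_im_le_norm _
      _ = ‖μ‖ * ‖P k‖ := by rw [norm_mul, hnμc]
  have hratio : ‖μ‖ * ‖1 - μ‖ ≤ 2 * w := by
    apply le_of_sq_le_sq _ (by linarith)
    rw [mul_pow, mul_pow, hnμ, hn1, hwsq]
    linarith
  set V := ∑ j ∈ Finset.range q, |e (j + 1) - e j| with hV
  have hsub : ∑ i ∈ Finset.range k, |e (i + 1) - e i| ≤ V :=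
    Finset.sum_le_sum_of_subset_of_nonneg (Finset.range_subset_range.2 hk)
      fun _ _ _ => abs_nonneg _
  have hpow : ‖μ‖ ^ k ≤ (1 - th / 2) ^ k := pow_le_pow_left₀ (norm_nonneg _) hμle k
  have hA : ‖μ‖ ^ k * |a| + ∑ i ∈ Finset.range k, |e (i + 1) - e i|
      ≤ (1 - th / 2) ^ k * |a| + V :=
    add_le_add (mul_le_mul_of_nonneg_right hpow (abs_nonneg _)) hsub
  have hA0 : 0 ≤ ‖μ‖ ^ k * |a| + ∑ i ∈ Finset.range k, |e (i + 1) - e i| :=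
    add_nonneg (mul_nonneg (pow_nonneg (norm_nonneg _) _) (abs_nonneg _))
      (Finset.sum_nonneg fun _ _ => abs_nonneg _)
  have hxle : |x| ≤ 2 * ((1 - th / 2) ^ k * |a| + V) := by
    refine le_of_mul_le_mul_left ?_ hwpos
    calc w * |x| ≤ ‖μ‖ * ‖P k‖ := hmodes
      _ ≤ ‖μ‖ * (‖1 - μ‖ * (‖μ‖ ^ k * |a| + ∑ i ∈ Finset.range k, |e (i + 1) - e i|)) :=
        mul_le_mul_of_nonneg_left (hbound k hk) (norm_nonneg _)
      _ = (‖μ‖ * ‖1 - μ‖) * (‖μ‖ ^ k * |a| + ∑ i ∈ Finset.range k, |e (i + 1) - e i|) := by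
        ring
      _ ≤ (2 * w) * ((1 - th / 2) ^ k * |a| + V) :=
        mul_le_mul hratio hA hA0 (by linarith)
      _ = _ := by ring
  have he := h.abs_e_le hk
  have : a + lam * s k = x - e k := by rw [hx]; ring
  rw [this]
  have := abs_sub x (e k)
  linarith

/-- Directions of negative curvature: the derivative satisfies a maximum principle. -/
lemma abs_deriv_le_of_neg (h : MomentumRec eta th lam a q s v e) (hth : 0 < th)
    (hth' : th ≤ 1 / 4) (hlam : eta * lam < -(4 * th ^ 2)) {k : ℕ} (hk : k ≤ q) :
    |a + lam * s k| ≤ (1 - th) ^ k * |a| + (1 - th) ^ (q - k) * |a + lam * s q|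
      + ∑ j ∈ Finset.range q, |e (j + 1) - e j| := by
  set m := ∑ j ∈ Finset.range q, |e (j + 1) - e j| with hm
  have hm0 : 0 ≤ m := Finset.sum_nonneg fun _ _ => abs_nonneg _
  set t := -(eta * lam) with ht
  have htpos : 4 * th ^ 2 < t := by linarith
  have hth2 : 0 < th ^ 2 := by positivity
  have ht0 : 0 < t := by linarith
  set σ := 1 - th with hσ
  have hσ0 : 0 ≤ σ := by linarith
  set Y := |a + lam * s q|
  -- The barrier decays from the two endpoint values. Its constant part `m` absorbs the error,
  -- because the coefficients satisfy `(1 + t)(2 - th) - (1 + t)(1 - th) - 1 = t`.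
  have key := discrete_max_principle (a := (1 + t) * (2 - th)) (b := (1 + t) * (1 - th))
    (q := q) (d := fun j => |a + lam * s j| - (σ ^ j * |a| + σ ^ (q - j) * Y + m))
    (mul_nonneg (by linarith) hσ0) (by nlinarith) ?_ ?_ ?_ k hk
  · linarith
  · simp only [h.s_zero, pow_zero, mul_zero, add_zero]
    have : 0 ≤ σ ^ (q - 0) * Y := by positivity
    linarith
  · simp only [Nat.sub_self, pow_zero]
    have : 0 ≤ σ ^ q * |a| := by positivity
    simp only [Y]
    linarith
  · intro j hj
    have e1 := h.s_succ (j + 1) (by omega)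
    have e2 := h.v_succ (j + 1) (by omega)
    have e3 := h.s_succ j (by omega)
    have hrec : (1 + t) * (2 - th) * (a + lam * s (j + 1))
        = (a + lam * s (j + 2)) + (1 + t) * (1 - th) * (a + lam * s j) - t * e (j + 1) := by
      have : v (j + 1) = s (j + 1) - s j := by linarith
      rw [e1, e2, this, ht]
      ring
    have habs : (1 + t) * (2 - th) * |a + lam * s (j + 1)|
        ≤ |a + lam * s (j + 2)| + (1 + t) * (1 - th) * |a + lam * s j| + t * m := by
      have hpos : 0 ≤ (1 + t) * (2 - th) := mul_nonneg (by linarith) (by linarith)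
      have hpos' : 0 ≤ (1 + t) * (1 - th) := mul_nonneg (by linarith) hσ0
      calc (1 + t) * (2 - th) * |a + lam * s (j + 1)|
          = |(1 + t) * (2 - th) * (a + lam * s (j + 1))| := by
            rw [abs_mul ((1 + t) * (2 - th)), abs_of_nonneg hpos]
        _ ≤ |a + lam * s (j + 2)| + |(1 + t) * (1 - th) * (a + lam * s j)| + |t * e (j + 1)| := by
            rw [hrec]
            exact (abs_sub _ _).trans (add_le_add_left (abs_add_le _ _) _)
        _ ≤ _ := by
            rw [abs_mul ((1 + t) * (1 - th)), abs_of_nonneg hpos', abs_mul t, abs_of_pos ht0]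
            have := mul_le_mul_of_nonneg_left (h.abs_e_le (i := j + 1) (by omega)) ht0.le
            linarith
    have hb1 : σ ^ (j + 2) + (1 + t) * (1 - th) * σ ^ j
        ≤ (1 + t) * (2 - th) * σ ^ (j + 1) := by
      have : 0 ≤ σ ^ j * (t * σ ^ 2) := by positivity
      have e4 : (1 + t) * (2 - th) * σ ^ (j + 1) - (σ ^ (j + 2) + (1 + t) * (1 - th) * σ ^ j)
        = σ ^ j * (t * σ ^ 2) := by rw [hσ]; ring
      linarith
    obtain ⟨i, hi⟩ : ∃ i, q = j + 2 + i := ⟨q - (j + 2), by omega⟩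
    have hi0 : q - (j + 2) = i := by omega
    have hi1 : q - (j + 1) = i + 1 := by omega
    have hi2 : q - j = i + 2 := by omega
    -- The growing half of the barrier is a supersolution only if `(1 + t)(1 - 2th² + th³) ≥ 1`; the
    -- threshold `4th²` on the curvature ensures this.
    have hb2 : σ ^ (q - (j + 2)) + (1 + t) * (1 - th) * σ ^ (q - j)
        ≤ (1 + t) * (2 - th) * σ ^ (q - (j + 1)) := by
      rw [hi0, hi1, hi2]
      have e5 : (1 + t) * (2 - th) * σ ^ (i + 1) - (σ ^ i + (1 + t) * (1 - th) * σ ^ (i + 2))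
        = σ ^ i * ((1 + t) * (1 - 2 * th ^ 2 + th ^ 3) - 1) := by rw [hσ]; ring
      have : 0 ≤ σ ^ i * ((1 + t) * (1 - 2 * th ^ 2 + th ^ 3) - 1) := by
        apply mul_nonneg (by positivity)
        have h3 : 0 < th ^ 3 := by positivity
        have hthsq : th ^ 2 ≤ 1 / 16 := by nlinarith
        nlinarith
      linarith
    have hb1' := mul_le_mul_of_nonneg_right hb1 (abs_nonneg a)
    have hb2' := mul_le_mul_of_nonneg_right hb2 (abs_nonneg (a + lam * s q))
    simp only [Y]
    linarith

/-- The sum of the gradients telescopes. -/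
lemma eta_mul_sum_grad (h : MomentumRec eta th lam a q s v e) {i : ℕ} (hi : i ≤ q) :
    eta * ∑ j ∈ Finset.range i, (a + lam * (s j + (1 - th) * v j) + e j)
      = -(v i + th * (s i - v i)) := by
  induction i with
  | zero => simp [h.s_zero, h.v_zero]
  | succ i ih =>
    rw [Finset.sum_range_succ, mul_add, ih (by omega), h.s_succ i (by omega)]
    linear_combination h.v_succ i (by omega)

/-- Directions of small curvature: the derivative is close to a weighted average of the gradients,
which is small. -/
lemma abs_deriv_le_of_small (h : MomentumRec eta th lam a q s v e) (heta : 0 < eta)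
    (hth : 0 < th) (hth' : th ≤ 1 / 4) (hlam : |eta * lam| ≤ 4 * th ^ 2) (hq : 0 < q) {k : ℕ}
    (hk : k ≤ q) :
    |a + lam * s k| ≤ (2 * (1 + th * q) / (eta * q ^ 2) + 8 * th ^ 2 / eta)
        * ∑ j ∈ Finset.range q, |v (j + 1)|
      + ∑ j ∈ Finset.range q, |e (j + 1) - e j| := by
  set m := ∑ j ∈ Finset.range q, |e (j + 1) - e j| with hm
  set P := ∑ j ∈ Finset.range q, |v (j + 1)| with hP
  have hP0 : 0 ≤ P := Finset.sum_nonneg fun _ _ => abs_nonneg _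
  set z := a + lam * s k with hz
  set g : ℕ → ℝ := fun j => a + lam * (s j + (1 - th) * v j) + e j with hg
  have hlam' : |lam| ≤ 4 * th ^ 2 / eta := by
    rw [le_div_iff₀ heta]
    rwa [abs_mul, abs_of_pos heta, mul_comm] at hlam
  have hclose : ∀ j < q, |z - g j| ≤ 8 * th ^ 2 / eta * P + m := by
    intro j hj
    have : z - g j = lam * ((s k - s j) - (1 - th) * v j) - e j := by rw [hz, hg]; ring
    rw [this]
    refine (abs_sub _ _).trans (add_le_add ?_ (h.abs_e_le hj.le))
    rw [abs_mul]
    have h1 : |(s k - s j) - (1 - th) * v j| ≤ 2 * P := by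
      refine (abs_sub _ _).trans ?_
      rw [abs_mul, abs_of_nonneg (by linarith : (0 : ℝ) ≤ 1 - th)]
      have h2 := h.abs_s_sub_le hk hj.le
      have h3 := h.abs_v_le hj.le
      have h4 : (1 - th) * |v j| ≤ 1 * |v j| :=
        mul_le_mul_of_nonneg_right (by linarith) (abs_nonneg _)
      linarith
    calc |lam| * |(s k - s j) - (1 - th) * v j| ≤ 4 * th ^ 2 / eta * (2 * P) :=
          mul_le_mul hlam' h1 (abs_nonneg _) (by positivity)
      _ = _ := by ring
  -- The sum of the first `i + 1` gradients is `-(v (i+1) + th * s i) / eta`. Summing once more over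
  -- `i` replaces `|v (i+1)|` by its mean, at most `P / q`, which is what produces `q²` in the
  -- denominator.
  have hone : ∀ i < q, |((i + 1 : ℕ) : ℝ) * z + (v (i + 1) + th * s i) / eta|
      ≤ ((i + 1 : ℕ) : ℝ) * (8 * th ^ 2 / eta * P + m) := by
    intro i hi
    have h1 : (v (i + 1) + th * s i) / eta = -∑ j ∈ Finset.range (i + 1), g j := by
      have h2 := h.eta_mul_sum_grad (i := i + 1) (by omega)
      have h3 := h.s_succ i hi
      rw [div_eq_iff heta.ne']
      rw [h3, add_sub_cancel_right] at h2
      linarith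
    have h4 : ((i + 1 : ℕ) : ℝ) * z + (v (i + 1) + th * s i) / eta
        = ∑ j ∈ Finset.range (i + 1), (z - g j) := by
      rw [h1, Finset.sum_sub_distrib, Finset.sum_const, Finset.card_range, nsmul_eq_mul]
      ring
    rw [h4]
    refine (Finset.abs_sum_le_sum_abs _ _).trans ?_
    refine (Finset.sum_le_sum (g := fun _ => 8 * th ^ 2 / eta * P + m) fun j hj =>
      hclose j ?_).trans ?_
    · have := Finset.mem_range.1 hj
      omega
    · rw [Finset.sum_const, Finset.card_range, nsmul_eq_mul]
  set N : ℝ := ∑ i ∈ Finset.range q, ((i + 1 : ℕ) : ℝ) with hN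
  have hNval : ∀ q : ℕ, ∑ i ∈ Finset.range q, ((i + 1 : ℕ) : ℝ) = q * (q + 1) / 2 := by
    intro q
    induction q with
    | zero => simp
    | succ q ih => rw [Finset.sum_range_succ, ih]; push_cast; ring
  have hqpos : (0 : ℝ) < q := by exact_mod_cast hq
  have hNpos : (q : ℝ) ^ 2 / 2 ≤ N := by
    rw [hN, hNval]
    nlinarith
  have hN0 : 0 < N := lt_of_lt_of_le (by positivity) hNpos
  have htot : |N * z| ≤ N * (8 * th ^ 2 / eta * P + m) + (1 + th * q) * P / eta := by
    have h1 : N * z = ∑ i ∈ Finset.range q, (((i + 1 : ℕ) : ℝ) * z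
        + (v (i + 1) + th * s i) / eta) - ∑ i ∈ Finset.range q, (v (i + 1) + th * s i) / eta := by
      rw [← Finset.sum_sub_distrib, hN, Finset.sum_mul]
      exact Finset.sum_congr rfl fun _ _ => by ring
    rw [h1]
    refine (abs_sub _ _).trans (add_le_add ?_ ?_)
    · rw [hN, Finset.sum_mul]
      exact (Finset.abs_sum_le_sum_abs _ _).trans
        (Finset.sum_le_sum fun i hi => hone i (Finset.mem_range.1 hi))
    · have h2 : ∀ i ∈ Finset.range q, |(v (i + 1) + th * s i) / eta|
          ≤ (|v (i + 1)| + th * P) / eta := by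
        intro i hi
        rw [abs_div, abs_of_pos heta]
        have h5 := h.abs_s_sub_le (i := i) (k := 0) (Finset.mem_range.1 hi).le (by omega)
        rw [h.s_zero, sub_zero] at h5
        have h6 := abs_add_le (v (i + 1)) (th * s i)
        rw [abs_mul, abs_of_pos hth] at h6
        have h7 := mul_le_mul_of_nonneg_left h5 hth.le
        gcongr
        linarith
      refine (Finset.abs_sum_le_sum_abs _ _).trans ((Finset.sum_le_sum h2).trans ?_)
      rw [← Finset.sum_div, Finset.sum_add_distrib, Finset.sum_const, Finset.card_range,
        nsmul_eq_mul]
      apply le_of_eq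
      rw [← hP]
      ring
  have hfrac : (1 + th * q) * P / eta ≤ N * (2 * (1 + th * q) / (eta * q ^ 2) * P) := by
    have h1 : (1 + th * q) * P / eta = (q ^ 2 / 2) * (2 * (1 + th * q) / (eta * q ^ 2) * P) := by
      field_simp
    rw [h1]
    exact mul_le_mul_of_nonneg_right hNpos (by positivity)
  rw [abs_mul, abs_of_pos hN0] at htot
  refine le_of_mul_le_mul_left ?_ hN0
  linarith

/-- In every direction, the derivative in the middle of the run is small. -/
lemma abs_deriv_le (h : MomentumRec eta th lam a q s v e) (heta : 0 < eta)
    (hth : 0 < th) (hth' : th ≤ 1 / 4) (hlam : |eta * lam| ≤ 1 / 4) (hq : 0 < q) {k : ℕ}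
    (hk : k ≤ q) :
    |a + lam * s k| ≤ (2 * (1 - th / 2) ^ k + (1 - th) ^ (q - k)) * |a|
      + ((1 - th) ^ (q - k) * (1 / (4 * eta)) + 2 * (1 + th * q) / (eta * q ^ 2)
          + 8 * th ^ 2 / eta) * ∑ j ∈ Finset.range q, |v (j + 1)|
      + 3 * ∑ j ∈ Finset.range q, |e (j + 1) - e j| := by
  have hV0 : 0 ≤ ∑ j ∈ Finset.range q, |e (j + 1) - e j| :=
    Finset.sum_nonneg fun _ _ => abs_nonneg _
  have hP0 : 0 ≤ ∑ j ∈ Finset.range q, |v (j + 1)| := Finset.sum_nonneg fun _ _ => abs_nonneg _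
  have hq0 : (0 : ℝ) < q := by exact_mod_cast hq
  have hσ0 : 0 ≤ 1 - th := by linarith
  have hσ1 : 0 ≤ 1 - th / 2 := by linarith
  have t1 : 0 ≤ (1 - th / 2) ^ k * |a| := by positivity
  have t2 : 0 ≤ (1 - th) ^ (q - k) * |a| := by positivity
  have t3 : 0 ≤ (1 - th) ^ (q - k) * (1 / (4 * eta)) * ∑ j ∈ Finset.range q, |v (j + 1)| := by
    positivity
  have t4 : 0 ≤ (2 * (1 + th * q) / (eta * q ^ 2) + 8 * th ^ 2 / eta)
      * ∑ j ∈ Finset.range q, |v (j + 1)| := by positivity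
  rcases lt_or_ge (4 * th ^ 2) (eta * lam) with hpos | hpos
  · have := h.abs_deriv_le_of_pos hth hth' hpos (abs_le.1 hlam).2 hk
    linarith
  rcases lt_or_ge (eta * lam) (-(4 * th ^ 2)) with hneg | hneg
  · have h1 := h.abs_deriv_le_of_neg hth hth' hneg hk
    -- The derivative at the far end need not be small. This crude bound suffices because it is
    -- multiplied by `(1 - th) ^ (q - k)`.
    have h2 : |a + lam * s q|
        ≤ |a| + 1 / (4 * eta) * ∑ j ∈ Finset.range q, |v (j + 1)| := by
      refine (abs_add_le _ _).trans (add_le_add_right ?_ _)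
      rw [abs_mul]
      have h3 := h.abs_s_sub_le (i := q) (k := 0) le_rfl (by omega)
      rw [h.s_zero, sub_zero] at h3
      refine mul_le_mul ?_ h3 (abs_nonneg _) (by positivity)
      rw [abs_mul, abs_of_pos heta] at hlam
      rw [le_div_iff₀ (by positivity)]
      linarith
    have h3 := mul_le_mul_of_nonneg_left h2 (pow_nonneg hσ0 (q - k))
    have h4 : (1 - th) ^ k * |a| ≤ (1 - th / 2) ^ k * |a| :=
      mul_le_mul_of_nonneg_right (pow_le_pow_left₀ hσ0 (by linarith) k) (abs_nonneg _)
    linarith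
  · have := h.abs_deriv_le_of_small heta hth hth' (abs_le.2 ⟨hneg, hpos⟩) hq hk
    linarith

end MomentumRec

/-! ## Vector gradient descent with momentum -/

/-- Minkowski's inequality for the coordinatewise absolute values. -/
lemma norm_le_of_coord_le {ι V : Type*} [Fintype ι] [NormedAddCommGroup V]
    [InnerProductSpace ℝ V] (b : OrthonormalBasis ι ℝ V) {q : ℕ} {A B C : ℝ} (hA : 0 ≤ A)
    (hB : 0 ≤ B) (hC : 0 ≤ C) {x a : V} {v d : ℕ → V}
    (h : ∀ i, |b.repr x i| ≤ A * |b.repr a i| + B * ∑ j ∈ Finset.range q, |b.repr (v j) i|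
      + C * ∑ j ∈ Finset.range q, |b.repr (d j) i|) :
    ‖x‖ ≤ A * ‖a‖ + B * ∑ j ∈ Finset.range q, ‖v j‖ + C * ∑ j ∈ Finset.range q, ‖d j‖ := by
  set N : V → EuclideanSpace ℝ ι := fun y => WithLp.toLp 2 fun i => |b.repr y i| with hN
  have hnorm : ∀ y, ‖N y‖ = ‖y‖ := fun y => by
    rw [← b.repr.norm_map y, EuclideanSpace.norm_eq, EuclideanSpace.norm_eq]
    simp [hN]
  have hle : ‖x‖ ≤ ‖A • N a + B • ∑ j ∈ Finset.range q, N (v j)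
      + C • ∑ j ∈ Finset.range q, N (d j)‖ := by
    rw [← hnorm x, EuclideanSpace.norm_eq, EuclideanSpace.norm_eq]
    refine Real.sqrt_le_sqrt (Finset.sum_le_sum fun i _ => ?_)
    rw [Real.norm_eq_abs, Real.norm_eq_abs]
    apply pow_le_pow_left₀ (abs_nonneg _)
    refine le_trans ?_ (le_abs_self _)
    simpa [hN] using h i
  refine hle.trans ((norm_add₃_le).trans ?_)
  rw [norm_smul, norm_smul, norm_smul, Real.norm_of_nonneg hA, Real.norm_of_nonneg hB,
    Real.norm_of_nonneg hC, hnorm]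
  gcongr
  · exact (norm_sum_le _ _).trans (le_of_eq (Finset.sum_congr rfl fun j _ => hnorm _))
  · exact (norm_sum_le _ _).trans (le_of_eq (Finset.sum_congr rfl fun j _ => hnorm _))

/-- For gradient descent with momentum on a quadratic function, with slowly varying errors, the
gradient in the middle of a long and short-ranged run is small. -/
lemma norm_deriv_le {V : Type*} [NormedAddCommGroup V] [InnerProductSpace ℝ V]
    [FiniteDimensional ℝ V] {eta th : ℝ} {T : V →L[ℝ] V} {a : V} {q : ℕ} {s v e : ℕ → V}
    (hT : T.toLinearMap.IsSymmetric) (hnorm : eta * ‖T‖ ≤ 1 / 4)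
    (hs0 : s 0 = 0) (hv0 : v 0 = 0) (he0 : e 0 = 0)
    (hv : ∀ j < q, v (j + 1) =
      (1 - th) • v j - eta • (a + T (s j + (1 - th) • v j) + e j))
    (hs : ∀ j < q, s (j + 1) = s j + v (j + 1))
    (heta : 0 < eta) (hth : 0 < th) (hth' : th ≤ 1 / 4) (hq : 0 < q) {k : ℕ} (hk : k ≤ q) :
    ‖a + T (s k)‖ ≤ (2 * (1 - th / 2) ^ k + (1 - th) ^ (q - k)) * ‖a‖
      + ((1 - th) ^ (q - k) * (1 / (4 * eta)) + 2 * (1 + th * q) / (eta * q ^ 2)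
          + 8 * th ^ 2 / eta) * ∑ j ∈ Finset.range q, ‖v (j + 1)‖
      + 3 * ∑ j ∈ Finset.range q, ‖e (j + 1) - e j‖ := by
  set b := hT.eigenvectorBasis rfl with hb
  have hcoord : ∀ x i, b.repr (T x) i = hT.eigenvalues rfl i * b.repr x i := fun x i => by
    have := hT.eigenvectorBasis_apply_self_apply rfl x i
    simpa using this
  have hq0 : (0 : ℝ) < q := by exact_mod_cast hq
  have hσ0 : 0 ≤ 1 - th := by linarith
  have hσ1 : 0 ≤ 1 - th / 2 := by linarith
  refine norm_le_of_coord_le b (v := fun j => v (j + 1)) (d := fun j => e (j + 1) - e j)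
    (by positivity) (by positivity) (by norm_num) fun i => ?_
  have hlam : |eta * hT.eigenvalues rfl i| ≤ 1 / 4 := by
    have h1 := hT.apply_eigenvectorBasis rfl i
    have h2 := T.le_opNorm (b i)
    have h3 : T (b i) = hT.eigenvalues rfl i • b i := h1
    rw [h3, norm_smul, b.norm_eq_one, mul_one, mul_one, Real.norm_eq_abs] at h2
    rw [abs_mul, abs_of_pos heta]
    exact (mul_le_mul_of_nonneg_left h2 heta.le).trans hnorm
  have hrec : MomentumRec eta th (hT.eigenvalues rfl i) (b.repr a i) q
      (fun j => b.repr (s j) i) (fun j => b.repr (v j) i) (fun j => b.repr (e j) i) := by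
    refine ⟨by simp [hs0], by simp [hv0], by simp [he0], fun j hj => ?_, fun j hj => ?_⟩
    · have := hcoord (s j + (1 - th) • v j) i
      simp only [map_add, map_smul, PiLp.add_apply, PiLp.smul_apply, smul_eq_mul] at this
      rw [hv j hj]
      simp only [map_add, map_sub, map_smul, PiLp.add_apply, PiLp.sub_apply, PiLp.smul_apply,
        smul_eq_mul]
      rw [this]
    · rw [hs j hj]
      simp
  have := hrec.abs_deriv_le heta hth hth' hlam hq hk
  simpa [hcoord] using this

/-! ## The iterates in one tangent space -/

section Landscape

variable {V : Type*} [NormedAddCommGroup V] [InnerProductSpace ℝ V]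

lemma norm_le_of_mem_segment {x y z : V} {R : ℝ} (hx : ‖x‖ ≤ R) (hy : ‖y‖ ≤ R)
    (hz : z ∈ segment ℝ x y) : ‖z‖ ≤ R := by
  have := (convex_closedBall (0 : V) R).segment_subset (x := x) (y := y)
    (by simpa using hx) (by simpa using hy) hz
  simpa using this

lemma norm_sub_le_of_mem_segment {x y z : V} (hz : z ∈ segment ℝ x y) : ‖z - x‖ ≤ ‖y - x‖ := by
  obtain ⟨t, ht, rfl⟩ := (segment_eq_image' ℝ x y) ▸ hz
  rw [add_sub_cancel_left, norm_smul, Real.norm_of_nonneg ht.1]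
  exact mul_le_of_le_one_left (norm_nonneg _) ht.2

/-- The point `u_j` at which the gradient is computed. -/
noncomputable def lookahead (p : Params) (x : V × V) : V := x.1 + (1 - thetaCap p x.1 x.2) • x.2

/-- One step of the accelerated iteration, on pairs of an iterate and its momentum. -/
noncomputable def stepPair (p : Params) (G : V → V) (x : V × V) : V × V :=
  (lookahead p x - p.eta • G (lookahead p x),
    lookahead p x - p.eta • G (lookahead p x) - x.1)

/-- The iterates and their momenta. -/
noncomputable def iterate (p : Params) (G : V → V) : ℕ → V × V
  | 0 => (0, 0)
  | j + 1 => stepPair p G (iterate p G j)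

/-- The length of the path of the first `j` steps. -/
noncomputable def pathLength (p : Params) (G : V → V) (j : ℕ) : ℝ :=
  ∑ i ∈ Finset.range j, ‖(iterate p G (i + 1)).2‖

/-- The Hamiltonian. -/
noncomputable def energy (p : Params) (F : V → ℝ) (x : V × V) : ℝ := F x.1 + 2 * p.ell * ‖x.2‖ ^ 2

section Iterates

variable {p : Params} {G : V → V}

/-- If the cap is active, the norm exceeds `2b` at `θ` and is at most `b` at `1`, so the
intermediate value theorem supplies the choice. -/
lemma thetaCap_spec (hth : p.theta ≤ 1) (hb : 0 < p.b) {s v : V} (hs : ‖s‖ ≤ p.b) :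
    p.theta ≤ thetaCap p s v ∧ thetaCap p s v ≤ 1 ∧
      ‖s + (1 - thetaCap p s v) • v‖ ≤ 2 * p.b := by
  unfold thetaCap
  split_ifs with h1 h2
  · exact ⟨le_rfl, hth, h1⟩
  · exact ⟨h2.choose_spec.1.1, h2.choose_spec.1.2, h2.choose_spec.2.le⟩
  · refine absurd ?_ h2
    have hcont : ContinuousOn (fun t : ℝ => ‖s + (1 - t) • v‖) (Set.Icc p.theta 1) := by fun_prop
    refine intermediate_value_Icc' hth hcont ⟨?_, (not_le.1 h1).le⟩
    simp only [sub_self, zero_smul, add_zero]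
    linarith

/-- Near the origin the cap is inactive, which makes the step linear on a quadratic model. -/
lemma thetaCap_eq (hth : 0 ≤ p.theta) (hth' : p.theta ≤ 1) {s v : V}
    (h : ‖s‖ + ‖v‖ ≤ 2 * p.b) : thetaCap p s v = p.theta := by
  unfold thetaCap
  rw [if_pos]
  refine (norm_add_le _ _).trans (le_trans ?_ h)
  rw [norm_smul, Real.norm_of_nonneg (by linarith)]
  have := mul_le_of_le_one_left (norm_nonneg v) (by linarith : 1 - p.theta ≤ 1)
  linarith

lemma iterate_succ_fst (j : ℕ) :
    (iterate p G (j + 1)).1 = (iterate p G j).1 + (iterate p G (j + 1)).2 := by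
  simp only [iterate, stepPair]
  abel

lemma pathLength_mono {i j : ℕ} (hij : i ≤ j) : pathLength p G i ≤ pathLength p G j :=
  Finset.sum_le_sum_of_subset_of_nonneg (Finset.range_subset_range.2 hij) fun _ _ _ => norm_nonneg _

lemma norm_iterate_fst_le (j : ℕ) : ‖(iterate p G j).1‖ ≤ pathLength p G j := by
  induction j with
  | zero => simp [iterate, pathLength]
  | succ j ih =>
    rw [iterate_succ_fst, pathLength, Finset.sum_range_succ]
    exact (norm_add_le _ _).trans (add_le_add_left ih _)

lemma norm_iterate_snd_le (j : ℕ) : ‖(iterate p G j).2‖ ≤ pathLength p G j := by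
  obtain _ | j := j
  · simp [iterate, pathLength]
  · exact Finset.single_le_sum (f := fun i => ‖(iterate p G (i + 1)).2‖)
      (fun _ _ => norm_nonneg _) (Finset.mem_range.2 (Nat.lt_succ_self j))

lemma apply_le_energy {V : Type*} [NormedAddCommGroup V] {F : V → ℝ} (hell : 0 < p.ell)
    (x : V × V) : F x.1 ≤ energy p F x :=
  le_add_of_nonneg_right (mul_nonneg (by linarith) (sq_nonneg _))

end Iterates

variable [CompleteSpace V]

/-! ## The local landscape -/

/-- `F` has gradient `G` and Hessian `H`, with `G` Lipschitz and `H` close to `H 0` on the ball of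
radius `3b`. -/
structure Landscape (F : V → ℝ) (G : V → V) (H : V → V →L[ℝ] V) (ell rho b : ℝ) : Prop where
  grad : ∀ x, HasGradientAt F (G x) x
  hess : ∀ x, HasFDerivAt G (H x) x
  symm : (H 0).toLinearMap.IsSymmetric
  lip : ∀ x y, ‖x‖ ≤ 3 * b → ‖y‖ ≤ 3 * b → ‖G x - G y‖ ≤ ell * ‖x - y‖
  hess_sub : ∀ x, ‖x‖ ≤ 3 * b → ‖H x - H 0‖ ≤ rho * ‖x‖

/-- Relations between the parameters of the algorithm, a length scale `r`, and a decrease `Δ` of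
the function. -/
structure Scales (p : Params) (r rho Δ : ℝ) : Prop where
  ell_pos : 0 < p.ell
  eta_eq : p.eta = 1 / (4 * p.ell)
  theta_pos : 0 < p.theta
  theta_le : p.theta ≤ 1 / 4
  gamma_eq : p.gamma = 4 * p.ell * p.theta ^ 2
  sbar_eq : p.sbar = r / 32
  eps_eq : p.eps = 16 * p.ell * p.theta ^ 2 * r
  rho_pos : 0 < rho
  rho_mul : rho * r = 16 * p.ell * p.theta ^ 2
  r_pos : 0 < r
  r_le : r ≤ p.b
  decrease_pos : 0 < Δ
  steps_mul_decrease : p.steps * Δ ≤ p.ell * p.theta * (r / 10 ^ 6) ^ 2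
  decrease_le : Δ ≤ p.ell * p.theta ^ 2 * r ^ 2 / 10 ^ 6
  four_dvd : 4 ∣ p.steps
  steps_mul_theta : 100 ≤ p.steps * p.theta
  exp_le : Real.exp (-(p.theta * p.steps / 8)) ≤ p.theta ^ 2

/-! ### Taylor estimates -/

lemma abs_sub_sub_inner_le {f : V → ℝ} {g : V → V} {x y : V} {C : ℝ}
    (hf : ∀ z, HasGradientAt f (g z) z) (hC : ∀ z ∈ segment ℝ x y, ‖g z - g x‖ ≤ C) :
    |f y - f x - inner ℝ (g x) (y - x)| ≤ C * ‖y - x‖ := by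
  have := (convex_segment x y).norm_image_sub_le_of_norm_hasFDerivWithin_le'
    (φ := InnerProductSpace.toDual ℝ V (g x))
    (fun z _ => (hf z).hasFDerivAt.hasFDerivWithinAt) (C := C)
    (fun z hz => by
      rw [← map_sub, LinearIsometryEquiv.norm_map]
      exact hC z hz) (left_mem_segment ℝ x y) (right_mem_segment ℝ x y)
  simpa using this

namespace Landscape

variable {F : V → ℝ} {G : V → V} {H : V → V →L[ℝ] V} {ell rho b : ℝ}

/-- The mean value inequality gives `ell` instead of the sharp `ell / 2`; the step size `1 / (4
ell)` leaves room for this loss. -/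
lemma abs_taylor_one_le (h : Landscape F G H ell rho b) (hell : 0 ≤ ell) {x y : V}
    (hx : ‖x‖ ≤ 3 * b) (hy : ‖y‖ ≤ 3 * b) :
    |F y - F x - inner ℝ (G x) (y - x)| ≤ ell * ‖y - x‖ ^ 2 := by
  have := abs_sub_sub_inner_le (C := ell * ‖y - x‖) h.grad (x := x) (y := y) fun z hz =>
    (h.lip z x (norm_le_of_mem_segment hx hy hz) hx).trans
      (mul_le_mul_of_nonneg_left (norm_sub_le_of_mem_segment hz) hell)
  rwa [mul_assoc, ← sq] at this

/-- The gradient minus its linearization at the origin is Lipschitz on small balls. -/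
lemma norm_remainder_sub_le (h : Landscape F G H ell rho b) (hrho : 0 ≤ rho) {R : ℝ}
    (hR : R ≤ 3 * b) {x y : V} (hx : ‖x‖ ≤ R) (hy : ‖y‖ ≤ R) :
    ‖(G y - G x) - H 0 (y - x)‖ ≤ rho * R * ‖y - x‖ := by
  refine (convex_closedBall (0 : V) R).norm_image_sub_le_of_norm_hasFDerivWithin_le'
    (fun z _ => (h.hess z).hasFDerivWithinAt) (fun z hz => ?_) (by simpa using hx)
    (by simpa using hy)
  have hz' : ‖z‖ ≤ R := by simpa using hz
  exact (h.hess_sub z (hz'.trans hR)).trans (mul_le_mul_of_nonneg_left hz' hrho)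

/-- The mean value estimate is applied to `F` minus the quadratic form of `H 0` centred at `x`. The
Hessian is only compared with its value at the origin, so the model uses `H 0` at every base point.
-/
lemma abs_taylor_two_le (h : Landscape F G H ell rho b) (hrho : 0 ≤ rho) {R : ℝ}
    (hR : R ≤ 3 * b) {x y : V} (hx : ‖x‖ ≤ R) (hy : ‖y‖ ≤ R) :
    |F y - F x - inner ℝ (G x) (y - x) - 1 / 2 * inner ℝ (y - x) (H 0 (y - x))|
      ≤ rho * R * ‖y - x‖ ^ 2 := by
  have hR0 : 0 ≤ R := (norm_nonneg _).trans hx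
  have hgrad : ∀ z, HasGradientAt (fun z => F z - 1 / 2 * inner ℝ (z - x) (H 0 (z - x)))
      (G z - H 0 (z - x)) z := by
    intro z
    rw [hasGradientAt_iff_hasFDerivAt]
    have h1 : HasFDerivAt (fun z => z - x) (ContinuousLinearMap.id ℝ V) z :=
      (hasFDerivAt_id z).sub_const x
    have h2 : HasFDerivAt (fun z => H 0 (z - x)) (H 0) z := (H 0).hasFDerivAt.comp z h1
    refine ((h.grad z).hasFDerivAt.sub ((h1.inner ℝ h2).const_mul (1 / 2))).congr_fderiv ?_
    ext w
    have hs : inner ℝ (H 0 (z - x)) w = inner ℝ (z - x) (H 0 w) := h.symm (z - x) w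
    have hc : inner ℝ w (H 0 (z - x)) = inner ℝ (H 0 (z - x)) w := real_inner_comm _ _
    simp only [sub_apply, InnerProductSpace.toDual_apply_apply,
      smul_apply, ContinuousLinearMap.comp_apply,
      ContinuousLinearMap.prod_apply, fderivInnerCLM_apply, ContinuousLinearMap.id_apply,
      smul_eq_mul, inner_sub_left (G z)]
    linarith
  have := abs_sub_sub_inner_le (C := rho * R * ‖y - x‖) hgrad (x := x) (y := y) fun z hz => by
    have h3 := h.norm_remainder_sub_le hrho hR hx (norm_le_of_mem_segment hx hy hz)
    have h4 : G z - H 0 (z - x) - (G x - H 0 (x - x)) = (G z - G x) - H 0 (z - x) := by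
      rw [sub_self, map_zero]; abel
    rw [h4]
    exact h3.trans
      (mul_le_mul_of_nonneg_left (norm_sub_le_of_mem_segment hz) (mul_nonneg hrho hR0))
  rw [mul_assoc, ← sq] at this
  convert this using 2
  simp
  ring

lemma norm_hess_zero_le (h : Landscape F G H ell rho b) (hell : 0 ≤ ell) (hb : 0 < b) :
    ‖H 0‖ ≤ ell := by
  refine (h.hess 0).le_of_lip' hell ?_
  filter_upwards [Metric.closedBall_mem_nhds (0 : V) (by linarith : 0 < 3 * b)] with x hx
  exact h.lip x 0 (by simpa using hx) (by simpa using by linarith)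

end Landscape

/-- The negative curvature condition. -/
def NegCurv (p : Params) (F : V → ℝ) (G : V → V) (x : V × V) : Prop :=
  F x.1 < F (lookahead p x) + inner ℝ (G (lookahead p x)) (x.1 - lookahead p x)
    - p.gamma / 2 * ‖x.1 - lookahead p x‖ ^ 2

/-- The first `j` steps start in the ball of radius `b` and meet no negative curvature. -/
def Descends (p : Params) (F : V → ℝ) (G : V → V) (j : ℕ) : Prop :=
  ∀ i < j, ¬ NegCurv p F G (iterate p G i) ∧ ‖(iterate p G i).1‖ ≤ p.b

variable {F : V → ℝ} {G : V → V} {H : V → V →L[ℝ] V} {rho r Δ : ℝ} {p : Params}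

/-- The cap puts the lookahead point in the ball of radius `2b`, and the gradient step moves it by
at most `3b/4`. All points thus stay where the Lipschitz and singular value assumptions hold. -/
lemma norm_stepPair_le (h : Landscape F G H p.ell rho p.b) (hp : Scales p r rho Δ)
    (hG : ‖G 0‖ ≤ p.ell * p.theta * r / 100) {x : V × V} (hx : ‖x.1‖ ≤ p.b) :
    ‖(stepPair p G x).1‖ ≤ 3 * p.b := by
  have hb : 0 < p.b := hp.r_pos.trans_le hp.r_le
  have hu : ‖lookahead p x‖ ≤ 2 * p.b :=
    (thetaCap_spec (by linarith [hp.theta_le]) hb hx).2.2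
  have h1 := h.lip (lookahead p x) 0 (by linarith) (by simpa using by linarith)
  rw [sub_zero] at h1
  have h2 : ‖G (lookahead p x)‖ ≤ p.ell * (3 * p.b) := by
    have h3 := norm_sub_norm_le (G (lookahead p x)) (G 0)
    have h4 := mul_le_mul_of_nonneg_left hu hp.ell_pos.le
    have h5 : p.ell * p.theta * r / 100 ≤ p.ell * p.b := by
      have : p.theta * r ≤ 1 * p.b :=
        mul_le_mul (by linarith [hp.theta_le]) hp.r_le hp.r_pos.le zero_le_one
      have := mul_le_mul_of_nonneg_left this hp.ell_pos.le
      have h6 : 0 ≤ p.ell * p.b := (mul_pos hp.ell_pos hb).le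
      linarith
    linarith
  have hell := hp.ell_pos
  calc ‖(stepPair p G x).1‖ ≤ ‖lookahead p x‖ + ‖p.eta • G (lookahead p x)‖ := norm_sub_le _ _
    _ ≤ 2 * p.b + p.eta * (p.ell * (3 * p.b)) := by
      rw [norm_smul, hp.eta_eq, Real.norm_of_nonneg (by positivity)]
      gcongr
    _ = 2 * p.b + 3 / 4 * p.b := by
      rw [hp.eta_eq]
      field_simp
    _ ≤ 3 * p.b := by linarith

/-- The Hamiltonian decreases along the iteration. -/
lemma energy_stepPair_le (h : Landscape F G H p.ell rho p.b) (hp : Scales p r rho Δ)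
    (hG : ‖G 0‖ ≤ p.ell * p.theta * r / 100) {x : V × V} (hx : ‖x.1‖ ≤ p.b)
    (hn : ¬ NegCurv p F G x) :
    energy p F (stepPair p G x) + p.ell * p.theta * ‖(stepPair p G x).2‖ ^ 2 ≤ energy p F x := by
  have hb : 0 < p.b := hp.r_pos.trans_le hp.r_le
  have hell := hp.ell_pos
  have hth := hp.theta_pos
  have hth' := hp.theta_le
  obtain ⟨ht1, ht2, hu⟩ := thetaCap_spec (v := x.2) (by linarith [hp.theta_le]) hb hx
  have hs' := norm_stepPair_le h hp hG hx
  obtain ⟨s, v⟩ := x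
  set τ := thetaCap p s v with hτ
  set u := s + (1 - τ) • v with hu_def
  have hlook : lookahead p (s, v) = u := rfl
  set g := G u with hg
  have hstep1 : (stepPair p G (s, v)).1 = u - p.eta • g := rfl
  have hstep2 : (stepPair p G (s, v)).2 = (1 - τ) • v - p.eta • g := by
    show u - p.eta • g - s = _
    rw [hu_def]; abel
  rw [hstep1] at hs'
  simp only [NegCurv, hlook, not_lt, ← hg] at hn
  have hsu : s - u = -((1 - τ) • v) := by rw [hu_def]; abel
  rw [hsu, inner_neg_right, inner_smul_right, norm_neg, norm_smul, mul_pow, Real.norm_eq_abs,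
    sq_abs, hp.gamma_eq] at hn
  have htay := h.abs_taylor_one_le hell.le (x := u) (y := u - p.eta • g) (by linarith) hs'
  have hdiff : u - p.eta • g - u = -(p.eta • g) := by abel
  have heta0 : 0 < p.eta := by rw [hp.eta_eq]; positivity
  rw [hdiff, ← hg, inner_neg_right, inner_smul_right, real_inner_self_eq_norm_sq, norm_neg,
    norm_smul, mul_pow, Real.norm_eq_abs, sq_abs] at htay
  have htay' := (abs_le.1 htay).2
  have hv'sq : ‖(1 - τ) • v - p.eta • g‖ ^ 2
      = (1 - τ) ^ 2 * ‖v‖ ^ 2 - 2 * p.eta * ((1 - τ) * inner ℝ g v) + p.eta ^ 2 * ‖g‖ ^ 2 := by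
    rw [norm_sub_sq_real, norm_smul, norm_smul, inner_smul_left, inner_smul_right,
      real_inner_comm, mul_pow, mul_pow, Real.norm_eq_abs, Real.norm_eq_abs, sq_abs, sq_abs]
    simp only [conj_trivial]
    ring
  have hv'le : ‖(1 - τ) • v - p.eta • g‖ ^ 2
      ≤ 2 * ((1 - τ) ^ 2 * ‖v‖ ^ 2) + 2 * (p.eta ^ 2 * ‖g‖ ^ 2) := by
    have h1 := parallelogram_law_with_norm ℝ ((1 - τ) • v) (p.eta • g)
    have h2 : 0 ≤ ‖(1 - τ) • v + p.eta • g‖ * ‖(1 - τ) • v + p.eta • g‖ := mul_self_nonneg _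
    have h3 : ‖(1 - τ) • v‖ * ‖(1 - τ) • v‖ = (1 - τ) ^ 2 * ‖v‖ ^ 2 := by
      rw [← sq, norm_smul, mul_pow, Real.norm_eq_abs, sq_abs]
    have h4 : ‖p.eta • g‖ * ‖p.eta • g‖ = p.eta ^ 2 * ‖g‖ ^ 2 := by
      rw [← sq, norm_smul, mul_pow, Real.norm_eq_abs, sq_abs]
    rw [sq]
    linarith
  have hl4 : p.ell * p.eta = 1 / 4 := by rw [hp.eta_eq]; field_simp
  simp only [energy, hstep1, hstep2]
  set X := ‖v‖ ^ 2 with hX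
  set Y := p.eta * ‖g‖ ^ 2 with hY
  have hX0 : 0 ≤ X := sq_nonneg _
  have hY0 : 0 ≤ Y := by positivity
  have hYY : p.ell * (p.eta ^ 2 * ‖g‖ ^ 2) = Y / 4 := by
    rw [hY]; linear_combination (p.eta * ‖g‖ ^ 2) * hl4
  -- The weight `2ℓ = 1/(2η)` of the kinetic energy is chosen so that its cross term cancels the
  -- term `(1 - τ)⟨g, v⟩` from the failed negative curvature test.
  have hin : 2 * p.ell * (2 * p.eta * ((1 - τ) * inner ℝ g v)) = (1 - τ) * inner ℝ g v := by
    linear_combination 4 * (1 - τ) * inner ℝ g v * hl4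
  -- The friction factor `(1 - τ)²` pays for three terms: the old kinetic energy, the claimed
  -- decrease (`θ`), and the curvature defect `γ/2 = 2ℓθ²` (`θ²`).
  have hcoef : (1 + p.theta + p.theta ^ 2) * (1 - τ) ^ 2 ≤ 1 := by
    have h1 : (1 - τ) ^ 2 ≤ (1 - p.theta) := by nlinarith
    have h2 : (1 + p.theta + p.theta ^ 2) * (1 - τ) ^ 2
        ≤ (1 + p.theta + p.theta ^ 2) * (1 - p.theta) :=
      mul_le_mul_of_nonneg_left h1 (by positivity)
    have h3 : 0 < p.theta ^ 3 := by positivity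
    linarith [show (1 + p.theta + p.theta ^ 2) * (1 - p.theta) = 1 - p.theta ^ 3 by ring]
  have hfin := mul_le_mul_of_nonneg_right hcoef (mul_nonneg (by linarith : 0 ≤ 2 * p.ell) hX0)
  have hkin : p.ell * p.theta * ‖(1 - τ) • v - p.eta • g‖ ^ 2
      ≤ 2 * p.ell * p.theta * ((1 - τ) ^ 2 * X) + p.theta * (Y / 2) := by
    have := mul_le_mul_of_nonneg_left hv'le (by positivity : 0 ≤ p.ell * p.theta)
    have e : p.ell * p.theta * (2 * (p.eta ^ 2 * ‖g‖ ^ 2)) = p.theta * (Y / 2) := by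
      linear_combination 2 * p.theta * hYY
    rw [mul_add, e] at this
    linarith
  have hthY : p.theta * (Y / 2) ≤ 1 / 4 * (Y / 2) :=
    mul_le_mul_of_nonneg_right hth' (by linarith)
  have hE : 2 * p.ell * ‖(1 - τ) • v - p.eta • g‖ ^ 2
      = 2 * p.ell * ((1 - τ) ^ 2 * X) - (1 - τ) * inner ℝ g v + Y / 2 := by
    rw [hv'sq, mul_add, mul_sub, hin]
    linear_combination 2 * hYY
  rw [hYY] at htay'
  rw [hE]
  linarith

lemma energy_add_sum_le (h : Landscape F G H p.ell rho p.b) (hp : Scales p r rho Δ)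
    (hG : ‖G 0‖ ≤ p.ell * p.theta * r / 100) {j : ℕ} (hd : Descends p F G j) :
    energy p F (iterate p G j)
      + p.ell * p.theta * ∑ i ∈ Finset.range j, ‖(iterate p G (i + 1)).2‖ ^ 2 ≤ F 0 := by
  induction j with
  | zero => simp [energy, iterate]
  | succ j ih =>
    have h1 := ih fun i hi => hd i (by omega)
    have h2 := energy_stepPair_le h hp hG (hd j (by omega)).2 (hd j (by omega)).1
    rw [Finset.sum_range_succ, mul_add]
    simp only [iterate] at h1 h2 ⊢
    linarith

lemma energy_le (h : Landscape F G H p.ell rho p.b) (hp : Scales p r rho Δ)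
    (hG : ‖G 0‖ ≤ p.ell * p.theta * r / 100) {i j : ℕ} (hij : i ≤ j) (hd : Descends p F G j) :
    energy p F (iterate p G j) ≤ energy p F (iterate p G i) := by
  induction j, hij using Nat.le_induction with
  | base => exact le_rfl
  | succ j hij ih =>
    refine le_trans ?_ (ih fun i hi => hd i (by omega))
    have h2 := energy_stepPair_le h hp hG (hd j (by omega)).2 (hd j (by omega)).1
    have : 0 ≤ p.ell * p.theta * ‖(stepPair p G (iterate p G j)).2‖ ^ 2 :=
      mul_nonneg (mul_pos hp.ell_pos hp.theta_pos).le (sq_nonneg _)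
    simp only [iterate]
    linarith

/-- Improve or localize. -/
lemma pathLength_le (h : Landscape F G H p.ell rho p.b) (hp : Scales p r rho Δ)
    (hG : ‖G 0‖ ≤ p.ell * p.theta * r / 100) {j : ℕ} (hj : j ≤ p.steps) (hd : Descends p F G j)
    (hE : F 0 - Δ < energy p F (iterate p G j)) : pathLength p G j ≤ r / 10 ^ 6 := by
  have hell := hp.ell_pos
  have hth := hp.theta_pos
  have hr := hp.r_pos
  have h1 := energy_add_sum_le h hp hG hd
  have h2 := sq_sum_le_card_mul_sum_sq (s := Finset.range j)
    (f := fun i => ‖(iterate p G (i + 1)).2‖)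
  set S := ∑ i ∈ Finset.range j, ‖(iterate p G (i + 1)).2‖ ^ 2 with hS
  have hS0 : 0 ≤ S := Finset.sum_nonneg fun _ _ => sq_nonneg _
  rw [Finset.card_range] at h2
  apply le_of_sq_le_sq _ (by positivity)
  refine h2.trans ?_
  have h3 : p.ell * p.theta * S ≤ Δ := by linarith
  have h4 : (j : ℝ) ≤ p.steps := by exact_mod_cast hj
  refine le_of_mul_le_mul_left ?_ (mul_pos hell hth)
  calc p.ell * p.theta * (j * S) = j * (p.ell * p.theta * S) := by ring
    _ ≤ p.steps * Δ := mul_le_mul h4 h3 (by positivity) (by positivity)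
    _ ≤ _ := hp.steps_mul_decrease

end Landscape

/-! ## Progress in one tangent space -/

section Progress

variable {V : Type*} [NormedAddCommGroup V] [InnerProductSpace ℝ V]
  {F : V → ℝ} {G : V → V} {H : V → V →L[ℝ] V} {rho r Δ : ℝ} {p : Params}

lemma lookahead_iterate_eq (hp : Scales p r rho Δ) {j : ℕ} (hP : pathLength p G j ≤ r / 10 ^ 6) :
    lookahead p (iterate p G j) = (iterate p G j).1 + (1 - p.theta) • (iterate p G j).2 := by
  have hr := hp.r_pos
  have hb := hp.r_le
  rw [lookahead, thetaCap_eq hp.theta_pos.le (by linarith [hp.theta_le])]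
  have h1 := norm_iterate_fst_le (p := p) (G := G) j
  have h2 := norm_iterate_snd_le (p := p) (G := G) j
  linarith

lemma Descends.mono {i j : ℕ} (hij : i ≤ j) (hd : Descends p F G j) : Descends p F G i :=
  fun k hk => hd k (hk.trans_le hij)

section

variable [CompleteSpace V]

/-- Negative curvature exploitation decreases the function. -/
lemma le_of_negCurv (h : Landscape F G H p.ell rho p.b) (hp : Scales p r rho Δ)
    (hG : ‖G 0‖ ≤ p.ell * p.theta * r / 100) {j : ℕ} (hj : j ≤ p.steps) (hd : Descends p F G j)
    (hs : ‖(iterate p G j).1‖ ≤ p.b) (hn : NegCurv p F G (iterate p G j)) {w : V}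
    (hw : F w ≤ F (iterate p G j).1)
    (hw' : ‖(iterate p G j).2‖ < p.sbar →
      F w ≤ F ((iterate p G j).1 + (p.sbar / ‖(iterate p G j).2‖) • (iterate p G j).2) ∧
      F w ≤ F ((iterate p G j).1 - (p.sbar / ‖(iterate p G j).2‖) • (iterate p G j).2)) :
    F w ≤ F 0 - Δ := by
  have hE0 : energy p F (iterate p G j) ≤ F 0 := by
    simpa [energy, iterate] using energy_le h hp hG (Nat.zero_le j) hd
  rcases le_or_gt (energy p F (iterate p G j)) (F 0 - Δ) with hE | hE
  · exact hw.trans ((apply_le_energy hp.ell_pos _).trans hE)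
  have hP := pathLength_le h hp hG hj hd hE
  clear hE
  have hsP := norm_iterate_fst_le (p := p) (G := G) j
  have hb : 0 < p.b := hp.r_pos.trans_le hp.r_le
  have hell := hp.ell_pos
  have hth := hp.theta_pos
  have hr := hp.r_pos
  have hrho := hp.rho_pos
  have hrb := hp.r_le
  obtain ⟨ht1, ht2, hu⟩ := thetaCap_spec (v := (iterate p G j).2) (by linarith [hp.theta_le]) hb hs
  generalize iterate p G j = x at hs hn hw hw' hE0 hsP ht1 ht2 hu
  obtain ⟨s, v⟩ := x
  simp only at hw hw' hsP hu ht1 ht2 hs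
  have hΔ := hp.decrease_le
  have h1 : 0 < p.ell * p.theta ^ 2 * r ^ 2 := by positivity
  -- With large momentum, `F s` lies below the Hamiltonian, hence below `F 0`, by `2ℓ sbar²`, which
  -- already exceeds `Δ`.
  rcases le_or_gt p.sbar ‖v‖ with hv | hv
  · have h2 : 2 * p.ell * p.sbar ^ 2 ≤ 2 * p.ell * ‖v‖ ^ 2 := by
      have : 0 ≤ p.sbar := by rw [hp.sbar_eq]; positivity
      gcongr
    simp only [energy] at hE0
    rw [hp.sbar_eq] at h2
    have h3 : p.ell * p.theta ^ 2 * r ^ 2 ≤ p.ell * 1 * r ^ 2 := by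
      have : p.theta ^ 2 ≤ 1 := by nlinarith [hp.theta_le]
      gcongr
    have h4 : 0 < p.ell * r ^ 2 := by positivity
    linarith
  obtain ⟨hw1, hw2⟩ := hw' hv
  set τ := thetaCap p s v with hτ
  set u := s + (1 - τ) • v with hu_def
  have hn' : F s < F u + inner ℝ (G u) (s - u) - p.gamma / 2 * ‖s - u‖ ^ 2 := hn
  -- Slightly more than `sbar + r / 10^6`, so the ball of radius `R` contains `s`, `u` and `s ± d`.
  set R := r / 31 with hR
  have hsR : ‖s‖ ≤ R := by linarith
  have hv32 : ‖v‖ ≤ r / 32 := by rw [← hp.sbar_eq]; exact hv.le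
  have huR : ‖u‖ ≤ R := by
    refine (norm_add_le _ _).trans ?_
    rw [norm_smul, Real.norm_of_nonneg (by linarith)]
    have := mul_le_of_le_one_left (norm_nonneg v) (by linarith : 1 - τ ≤ 1)
    linarith
  have hRb : R ≤ 3 * p.b := by linarith
  have hρR : rho * R = 16 / 31 * (p.ell * p.theta ^ 2) := by
    rw [hR]; linear_combination hp.rho_mul / 31
  have hsu : s - u = -((1 - τ) • v) := by rw [hu_def]; abel
  have htay := (abs_le.1 (h.abs_taylor_two_le hrho.le hRb huR hsR)).1
  have hquad : inner ℝ (s - u) (H 0 (s - u)) < (-p.gamma + 2 * (rho * R)) * ‖s - u‖ ^ 2 := by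
    linarith
  -- Strictness of the test excludes zero momentum, so the normalized direction below is meaningful.
  have hτv : s - u ≠ 0 := by
    intro h0
    rw [h0] at hquad
    simp at hquad
  have hτ0 : 1 - τ ≠ 0 := by
    intro h0
    rw [hsu, h0] at hτv
    simp at hτv
  have hv0 : v ≠ 0 := by
    intro h0
    rw [hsu, h0] at hτv
    simp at hτv
  have hnv : 0 < ‖v‖ := norm_pos_iff.2 hv0
  have hquadv : inner ℝ v (H 0 v) < (-p.gamma + 2 * (rho * R)) * ‖v‖ ^ 2 := by
    rw [hsu, map_neg, map_smul, inner_neg_neg, inner_smul_left, inner_smul_right, norm_neg,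
      norm_smul, mul_pow, Real.norm_eq_abs, sq_abs] at hquad
    simp only [conj_trivial] at hquad
    have h0 : 0 < (1 - τ) ^ 2 := by positivity
    refine lt_of_mul_lt_mul_left ?_ h0.le
    linarith
  set d := (p.sbar / ‖v‖) • v with hd_def
  have hsb : 0 < p.sbar := by rw [hp.sbar_eq]; positivity
  have hdn : ‖d‖ = p.sbar := by
    rw [hd_def, norm_smul, Real.norm_of_nonneg (by positivity), div_mul_cancel₀ _ hnv.ne']
  have hquadd : inner ℝ d (H 0 d) ≤ (-p.gamma + 2 * (rho * R)) * p.sbar ^ 2 := by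
    rw [hd_def, map_smul, inner_smul_left, inner_smul_right]
    simp only [conj_trivial]
    calc p.sbar / ‖v‖ * (p.sbar / ‖v‖ * inner ℝ v (H 0 v))
        = (p.sbar / ‖v‖) ^ 2 * inner ℝ v (H 0 v) := by ring
      _ ≤ (p.sbar / ‖v‖) ^ 2 * ((-p.gamma + 2 * (rho * R)) * ‖v‖ ^ 2) :=
        mul_le_mul_of_nonneg_left hquadv.le (by positivity)
      _ = _ := by field_simp
  have hdR : ‖s‖ + ‖d‖ ≤ R := by rw [hdn, hp.sbar_eq]; linarith
  have hp1 := (abs_le.1 (h.abs_taylor_two_le hrho.le hRb hsR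
    ((norm_add_le s d).trans hdR))).2
  have hp2 := (abs_le.1 (h.abs_taylor_two_le hrho.le hRb hsR
    ((norm_sub_le s d).trans hdR))).2
  have e1 : s + d - s = d := by abel
  have e2 : s - d - s = -d := by abel
  rw [e1, hdn] at hp1
  rw [e2, map_neg, inner_neg_neg, inner_neg_right, norm_neg, hdn] at hp2
  have hfs := (apply_le_energy (F := F) hell (s, v)).trans hE0
  -- The linear terms at `s + d` and `s - d` are opposite, so averaging the two bounds leaves the
  -- quadratic gain. With `γ = 4ℓθ²` and `ρR = (16/31)ℓθ²` the coefficient is `-2 + 32/31`.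
  have hcoef : (-p.gamma + 2 * (rho * R)) * p.sbar ^ 2 / 2 + rho * R * p.sbar ^ 2
      = -(30 / 31) * (p.ell * p.theta ^ 2) * p.sbar ^ 2 := by
    rw [hp.gamma_eq, hρR]; ring
  have hsb2 : p.ell * p.theta ^ 2 * p.sbar ^ 2 = p.ell * p.theta ^ 2 * r ^ 2 / 1024 := by
    rw [hp.sbar_eq]; ring
  linarith

/-- An iterate outside of the ball of radius `b` has decreased the function. -/
lemma le_of_lt_norm_iterate (h : Landscape F G H p.ell rho p.b) (hp : Scales p r rho Δ)
    (hG : ‖G 0‖ ≤ p.ell * p.theta * r / 100) {j : ℕ} (hj : j ≤ p.steps) (hd : Descends p F G j)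
    (hb : p.b < ‖(iterate p G j).1‖) : F (iterate p G j).1 ≤ F 0 - Δ := by
  rcases le_or_gt (energy p F (iterate p G j)) (F 0 - Δ) with hE | hE
  · exact (apply_le_energy hp.ell_pos _).trans hE
  · have h1 := pathLength_le h hp hG hj hd hE
    have h2 := norm_iterate_fst_le (p := p) (G := G) j
    linarith [hp.r_pos, hp.r_le]

end

variable [FiniteDimensional ℝ V] [CompleteSpace V]

/-- If half of the run does not decrease the function, then the gradient is small after a quarter
of the run. -/
lemma norm_grad_le (h : Landscape F G H p.ell rho p.b) (hp : Scales p r rho Δ)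
    (hG : ‖G 0‖ ≤ p.ell * p.theta * r / 100) {k : ℕ} (hk : p.steps = 4 * k)
    (hd : Descends p F G (2 * k)) (hE : F 0 - Δ < energy p F (iterate p G (2 * k))) :
    ‖G (iterate p G k).1‖ ≤ p.eps / 2 := by
  have hell := hp.ell_pos
  have hth := hp.theta_pos
  have hth' := hp.theta_le
  have hr := hp.r_pos
  have hrho := hp.rho_pos
  have hrb := hp.r_le
  have hb : 0 < p.b := hr.trans_le hrb
  have hsteps : (p.steps : ℝ) = 4 * k := by exact_mod_cast hk
  have hX := hp.steps_mul_theta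
  rw [hsteps] at hX
  have hk0 : 0 < k := by
    rcases Nat.eq_zero_or_pos k with rfl | hk0
    · norm_num at hX
    · exact hk0
  have hP := pathLength_le h hp hG (by omega) hd hE
  set P := pathLength p G (2 * k) with hPdef
  have hP0 : 0 ≤ P := Finset.sum_nonneg fun _ _ => norm_nonneg _
  have hPi : ∀ i ≤ 2 * k, pathLength p G i ≤ P := fun i hi => pathLength_mono hi
  set s : ℕ → V := fun i => (iterate p G i).1 with hs_def
  set v : ℕ → V := fun i => (iterate p G i).2 with hv_def
  have hsi : ∀ i ≤ 2 * k, ‖s i‖ ≤ P := fun i hi => (norm_iterate_fst_le i).trans (hPi i hi)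
  have hvi : ∀ i ≤ 2 * k, ‖v i‖ ≤ P := fun i hi => (norm_iterate_snd_le i).trans (hPi i hi)
  set u : ℕ → V := fun i => s i + (1 - p.theta) • v i with hu_def
  have hlook : ∀ i ≤ 2 * k, lookahead p (iterate p G i) = u i := fun i hi =>
    lookahead_iterate_eq hp ((hPi i hi).trans hP)
  have hui : ∀ i ≤ 2 * k, ‖u i‖ ≤ 2 * P := fun i hi => by
    refine (norm_add_le _ _).trans ?_
    rw [norm_smul, Real.norm_of_nonneg (by linarith)]
    have h1 := mul_le_of_le_one_left (norm_nonneg (v i)) (by linarith : 1 - p.theta ≤ 1)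
    linarith [hsi i hi, hvi i hi]
  -- The defect of the linearization at the origin: with it the true iteration is exactly momentum
  -- descent for `H 0`.
  set e : ℕ → V := fun i => G (u i) - G 0 - H 0 (u i) with he_def
  have hs : ∀ i < 2 * k, s (i + 1) = s i + v (i + 1) := fun i _ => iterate_succ_fst i
  have hv : ∀ i < 2 * k, v (i + 1) =
      (1 - p.theta) • v i - p.eta • (G 0 + H 0 (s i + (1 - p.theta) • v i) + e i) := by
    intro i hi
    have h1 : v (i + 1) = u i - p.eta • G (u i) - s i := by
      simp only [hv_def, iterate, stepPair, hlook i hi.le]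
      rfl
    have h2 : G 0 + H 0 (s i + (1 - p.theta) • v i) + e i = G (u i) := by
      simp only [he_def, hu_def]; abel
    rw [h1, h2]
    simp only [hu_def]
    abel
  have hs0 : s 0 = 0 := rfl
  have hv0 : v 0 = 0 := rfl
  have hu0 : u 0 = 0 := by simp [hu_def, hs0, hv0]
  have he0 : e 0 = 0 := by simp [he_def, hu0]
  have heta0 : 0 < p.eta := by rw [hp.eta_eq]; positivity
  have hnorm : p.eta * ‖H 0‖ ≤ 1 / 4 := by
    have := mul_le_mul_of_nonneg_left (h.norm_hess_zero_le hell.le hb) heta0.le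
    refine this.trans (le_of_eq ?_)
    rw [hp.eta_eq]; field_simp
  have key := norm_deriv_le h.symm hnorm hs0 hv0 he0 hv hs heta0 hth hth' (by omega)
    (k := k) (by omega)
  have hvar : ∑ j ∈ Finset.range (2 * k), ‖e (j + 1) - e j‖ ≤ 6 * (rho * P ^ 2) := by
    have h1 : ∀ j ∈ Finset.range (2 * k), ‖e (j + 1) - e j‖
        ≤ rho * (2 * P) * (2 * ‖v (j + 1)‖ + ‖v j‖) := by
      intro j hj
      have hj' : j < 2 * k := Finset.mem_range.1 hj
      have h2 : e (j + 1) - e j = (G (u (j + 1)) - G (u j)) - H 0 (u (j + 1) - u j) := by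
        simp only [he_def, map_sub]; abel
      have h3 : u (j + 1) - u j = v (j + 1) + (1 - p.theta) • (v (j + 1) - v j) := by
        simp only [hu_def, hs j hj', smul_sub]; abel
      rw [h2]
      refine (h.norm_remainder_sub_le hrho.le (by linarith) (hui j hj'.le)
        (hui (j + 1) hj')).trans ?_
      refine mul_le_mul_of_nonneg_left ?_ (by positivity)
      rw [h3]
      refine (norm_add_le _ _).trans ?_
      rw [norm_smul, Real.norm_of_nonneg (by linarith)]
      have h4 := mul_le_of_le_one_left (norm_nonneg (v (j + 1) - v j))
        (by linarith : 1 - p.theta ≤ 1)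
      linarith [norm_sub_le (v (j + 1)) (v j)]
    refine (Finset.sum_le_sum h1).trans ?_
    rw [← Finset.mul_sum, Finset.sum_add_distrib, ← Finset.mul_sum]
    have h5 : ∑ j ∈ Finset.range (2 * k), ‖v j‖ ≤ P := by
      have h6 := Finset.sum_range_succ' (fun j => ‖v j‖) (2 * k)
      rw [Finset.sum_range_succ, hv0, norm_zero, add_zero] at h6
      have h7 : ∑ j ∈ Finset.range (2 * k), ‖v (j + 1)‖ = P := rfl
      linarith [norm_nonneg (v (2 * k))]
    have h7 : ∑ j ∈ Finset.range (2 * k), ‖v (j + 1)‖ = P := rfl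
    rw [h7]
    calc rho * (2 * P) * (2 * P + ∑ j ∈ Finset.range (2 * k), ‖v j‖)
        ≤ rho * (2 * P) * (2 * P + P) := by gcongr
      _ = _ := by ring
  have hrem : ‖G (s k) - G 0 - H 0 (s k)‖ ≤ rho * P ^ 2 := by
    have h1 := h.norm_remainder_sub_le hrho.le (by linarith : P ≤ 3 * p.b) (x := 0)
      (y := s k) (by simpa using hP0) (hsi k (by omega))
    rw [sub_zero] at h1
    refine h1.trans ?_
    calc rho * P * ‖s k‖ ≤ rho * P * P := by
          gcongr
          exact hsi k (by omega)
      _ = _ := by ring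
  -- The decay must reach `θ²`, since it multiplies terms of order `ℓr` while `ε` is of order
  -- `ℓθ²r`. Here `θk/2` is `θ/8` times the number of steps.
  have hexp : (1 - p.theta / 2) ^ k ≤ p.theta ^ 2 := by
    refine le_trans ?_ hp.exp_le
    have h1 : 1 - p.theta / 2 ≤ Real.exp (-(p.theta / 2)) := by
      linarith [Real.add_one_le_exp (-(p.theta / 2))]
    refine (pow_le_pow_left₀ (by linarith) h1 k).trans (le_of_eq ?_)
    rw [← Real.exp_nat_mul, hsteps]
    congr 1
    ring
  have hexp' : (1 - p.theta) ^ (2 * k - k) ≤ p.theta ^ 2 := by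
    rw [show 2 * k - k = k by omega]
    exact (pow_le_pow_left₀ (by linarith) (by linarith) k).trans hexp
  have h7 : ∑ j ∈ Finset.range (2 * k), ‖v (j + 1)‖ = P := rfl
  rw [h7] at key
  set D := (1 - p.theta) ^ (2 * k - k) with hD
  have hD0 : 0 ≤ D := pow_nonneg (by linarith) _
  -- This reduces to `2 + 4θk ≤ (θk)²`, which holds as `θk ≥ 25`.
  have hcoef : 2 * (1 + p.theta * ((2 * k : ℕ) : ℝ)) / (p.eta * ((2 * k : ℕ) : ℝ) ^ 2)
      ≤ p.ell * p.theta ^ 2 := by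
    have hk0' : (0 : ℝ) < k := by exact_mod_cast hk0
    push_cast
    rw [hp.eta_eq, div_le_iff₀ (by positivity)]
    have h8 : p.ell * p.theta ^ 2 * (1 / (4 * p.ell) * (2 * (k : ℝ)) ^ 2)
        = (p.theta * k) ^ 2 := by field_simp; ring
    rw [h8]
    nlinarith
  have hcoef2 : 8 * p.theta ^ 2 / p.eta = 32 * (p.ell * p.theta ^ 2) := by
    rw [hp.eta_eq]; field_simp; ring
  have hcoef3 : D * (1 / (4 * p.eta)) ≤ p.ell * p.theta ^ 2 := by
    have : 1 / (4 * p.eta) = p.ell := by rw [hp.eta_eq]; field_simp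
    rw [this, mul_comm]
    gcongr
  have hA : (2 * (1 - p.theta / 2) ^ k + D) * ‖G 0‖
      ≤ 3 * p.theta ^ 2 * (p.ell * p.theta * r / 100) :=
    mul_le_mul (by linarith) hG (norm_nonneg _) (by positivity)
  have hA' : 3 * p.theta ^ 2 * (p.ell * p.theta * r / 100) ≤ p.ell * p.theta ^ 2 * r := by
    have : p.ell * p.theta ^ 2 * r * p.theta ≤ p.ell * p.theta ^ 2 * r * 1 := by
      gcongr; linarith
    have h9 : 0 < p.ell * p.theta ^ 2 * r := by positivity
    linarith
  have hB : (D * (1 / (4 * p.eta))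
      + 2 * (1 + p.theta * ((2 * k : ℕ) : ℝ)) / (p.eta * ((2 * k : ℕ) : ℝ) ^ 2)
      + 8 * p.theta ^ 2 / p.eta) * P ≤ 34 * (p.ell * p.theta ^ 2) * (r / 10 ^ 6) :=
    mul_le_mul (by linarith) hP hP0 (by positivity)
  have hρP : rho * P ^ 2 ≤ 16 * p.ell * p.theta ^ 2 * r / 10 ^ 12 := by
    calc rho * P ^ 2 ≤ rho * (r / 10 ^ 6) ^ 2 := by gcongr
      _ = (rho * r) * r / 10 ^ 12 := by ring
      _ = _ := by rw [hp.rho_mul]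
  have hGk : ‖G (s k)‖ ≤ ‖G 0 + H 0 (s k)‖ + ‖G (s k) - G 0 - H 0 (s k)‖ := by
    refine le_trans (le_of_eq ?_) (norm_add_le _ _)
    congr 1
    abel
  have h9 : 0 < p.ell * p.theta ^ 2 * r := by positivity
  show ‖G (s k)‖ ≤ _
  rw [hp.eps_eq]
  linarith

/-- If half of the run does not reach a small gradient, then it decreases the function. -/
lemma energy_half_le (h : Landscape F G H p.ell rho p.b) (hp : Scales p r rho Δ)
    (hG : ‖G 0‖ ≤ p.ell * p.theta * r / 100) (hd : Descends p F G (p.steps / 2))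
    (hlarge : ∀ i < p.steps / 2, p.eps / 2 < ‖G (iterate p G (i + 1)).1‖) :
    energy p F (iterate p G (p.steps / 2)) ≤ F 0 - Δ := by
  by_contra! hE
  obtain ⟨k, hk⟩ := hp.four_dvd
  have h2 : p.steps / 2 = 2 * k := by omega
  rw [h2] at hd hE hlarge
  have h1 := norm_grad_le h hp hG hk hd hE
  -- The lower bound covers the iterates from index 1 on, so `k = 0` has to be excluded.
  obtain _ | k := k
  · have := hp.steps_mul_theta
    rw [hk] at this
    norm_num at this
  · exact absurd h1 (not_le.2 (hlarge k (by omega)))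

end Progress

/-! ## Runs of programs -/

/-- With the answers of the oracle, the program `P` continues as the program `Q` after `nv` function
queries, `ng` gradient queries and `nr` calls to the retraction. -/
structure Runs {M : Type*} {T : M → Type*} {α : Type*} (O : Oracle M T) (P Q : Prog M T α)
    (nv ng nr : ℕ) : Prop where
  output_eq : P.output O = Q.output O
  valueQueries_eq : P.valueQueries O = Q.valueQueries O + nv
  gradQueries_eq : P.gradQueries O = Q.gradQueries O + ng
  retractCalls_eq : P.retractCalls O = Q.retractCalls O + nr

namespace Runs

variable {M : Type*} {T : M → Type*} {α : Type*} {O : Oracle M T} {P Q : Prog M T α}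
  {nv ng nr : ℕ} {x : M} {s : T x}

lemma refl (O : Oracle M T) (P : Prog M T α) : Runs O P P 0 0 0 := ⟨rfl, rfl, rfl, rfl⟩

lemma trans {S : Prog M T α} {nv' ng' nr' : ℕ} (h : Runs O P Q nv ng nr)
    (h' : Runs O Q S nv' ng' nr') : Runs O P S (nv' + nv) (ng' + ng) (nr' + nr) :=
  ⟨h.1.trans h'.1, by rw [h.2, h'.2, add_assoc], by rw [h.3, h'.3, add_assoc],
    by rw [h.4, h'.4, add_assoc]⟩

lemma value {k : ℝ → Prog M T α} (h : Runs O (k (O.value x s)) Q nv ng nr) :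
    Runs O (.value x s k) Q (nv + 1) ng (nr + 1) :=
  ⟨h.1, congrArg (· + 1) h.2, h.3, congrArg (· + 1) h.4⟩

lemma pullGrad {k : T x → Prog M T α} (h : Runs O (k (O.pullGrad x s)) Q nv ng nr) :
    Runs O (.pullGrad x s k) Q nv (ng + 1) (nr + 1) :=
  ⟨h.1, h.2, congrArg (· + 1) h.3, congrArg (· + 1) h.4⟩

lemma grad {k : T x → Prog M T α} (h : Runs O (k (O.grad x)) Q nv ng nr) :
    Runs O (.grad x k) Q nv (ng + 1) nr :=
  ⟨h.1, h.2, congrArg (· + 1) h.3, h.4⟩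

lemma retract {k : M → Prog M T α} (h : Runs O (k (O.retract x s)) Q nv ng nr) :
    Runs O (.retract x s k) Q nv ng (nr + 1) :=
  ⟨h.1, h.2, h.3, congrArg (· + 1) h.4⟩

lemma ite_pos {c : Prop} [Decidable c] {P' : Prog M T α} (hc : c) (h : Runs O P Q nv ng nr) :
    Runs O (if c then P else P') Q nv ng nr := by rwa [if_pos hc]

lemma ite_neg {c : Prop} [Decidable c] {P' : Prog M T α} (hc : ¬ c) (h : Runs O P Q nv ng nr) :
    Runs O (if c then P' else P) Q nv ng nr := by rwa [if_neg hc]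

end Runs

/-! ### Tangent space steps as oracle programs -/

section Loop

variable {M : Type*} {T : M → Type*} [∀ x, NormedAddCommGroup (T x)]
  [∀ x, InnerProductSpace ℝ (T x)] {O : Oracle M T} {p : Params} {x : M}

lemma nce_runs (α : Type*) (O : Oracle M T) (r : ArgminRule) (s v : T x) :
    ∃ (w : T x) (m : ℕ), m ≤ 3 ∧
      (∀ k : M → Prog M T α, Runs O (nce p r x s v fun w => .retract x w k)
        (k (O.retract x w)) m 0 (m + 1)) ∧
      O.value x w ≤ O.value x s ∧
      (‖v‖ < p.sbar → O.value x w ≤ O.value x (s + (p.sbar / ‖v‖) • v) ∧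
        O.value x w ≤ O.value x (s - (p.sbar / ‖v‖) • v)) := by
  unfold nce
  split_ifs with hv
  · exact ⟨s, 0, by norm_num, fun _ => (Runs.refl O _).retract, le_rfl, fun h => absurd hv (not_le.2 h)⟩
  · set d := (p.sbar / ‖v‖) • v with hd
    set a : Fin 3 → ℝ := ![O.value x s, O.value x (s + d), O.value x (s - d)] with ha
    set w : T x := ![s, s + d, s - d] (r.sel a) with hw
    have hwa : O.value x w = a (r.sel a) := by
      rw [hw]
      generalize r.sel a = i
      fin_cases i <;> rfl
    refine ⟨w, 3, le_rfl, fun _ => (Runs.refl O _).retract.value.value.value, ?_, fun _ => ⟨?_, ?_⟩⟩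
    · rw [hwa]; exact r.sel_le a 0
    · rw [hwa]; exact r.sel_le a 1
    · rw [hwa]; exact r.sel_le a 2

/-- The induction is on the remaining steps `n`, with `j` steps done. The first alternative bounds
the remaining queries by `n`. The second arises only while `j` is below half of the steps, so its
bounds are in terms of half of the run. -/
lemma tssLoop_runs (α : Type*) [FiniteDimensional ℝ (T x)] [CompleteSpace (T x)]
    {H : T x → T x →L[ℝ] T x} {rho l Δ : ℝ}
    (h : Landscape (O.value x) (O.pullGrad x) H p.ell rho p.b) (hp : Scales p l rho Δ)
    (hG : ‖O.pullGrad x 0‖ ≤ p.ell * p.theta * l / 100) (r : ArgminRule)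
    (n j : ℕ) (hj : j + n = p.steps) (hd : Descends p (O.value x) (O.pullGrad x) j)
    (hs : ‖(iterate p (O.pullGrad x) j).1‖ ≤ p.b)
    (hlarge : ∀ i < j, p.eps / 2 < ‖O.pullGrad x (iterate p (O.pullGrad x) (i + 1)).1‖) :
    ∃ (w : T x) (nv ng nr : ℕ),
      (∀ k : M → Prog M T α, Runs O
        (tssLoop p r x k n (iterate p (O.pullGrad x) j).1 (iterate p (O.pullGrad x) j).2)
        (k (O.retract x w)) nv ng nr) ∧
      ((O.value x w ≤ O.value x 0 - Δ ∧ nv ≤ 2 * n + 3 ∧ ng ≤ 2 * n ∧ nr ≤ 4 * n + 4) ∨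
        (O.value x w ≤ O.value x 0 ∧ ‖w‖ ≤ 3 * p.b ∧ ‖O.pullGrad x w‖ ≤ p.eps / 2 ∧
          nv + 2 * j ≤ p.steps ∧ ng + 2 * j ≤ p.steps ∧ nr + 4 * j ≤ 2 * p.steps + 1)) := by
  have hhalf : ∀ i, p.steps / 2 ≤ i → Descends p (O.value x) (O.pullGrad x) i →
      (∀ i < p.steps / 2, p.eps / 2 < ‖O.pullGrad x (iterate p (O.pullGrad x) (i + 1)).1‖) →
      O.value x (iterate p (O.pullGrad x) i).1 ≤ O.value x 0 - Δ := fun i hi hdi hli =>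
    ((apply_le_energy hp.ell_pos _).trans (energy_le h hp hG hi hdi)).trans
      (energy_half_le h hp hG (hdi.mono hi) hli)
  induction n generalizing j with
  | zero =>
    refine ⟨_, _, _, _, fun _ => (Runs.refl O _).retract, Or.inl ⟨?_, by omega, by omega, by omega⟩⟩
    exact hhalf j (by omega) hd fun i hi => hlarge i (by omega)
  | succ n ih =>
    set G := O.pullGrad x with hG_def
    by_cases hn : NegCurv p (O.value x) G (iterate p G j)
    · obtain ⟨w, m, hm, hruns, hw1, hw2⟩ :=
        nce_runs α O (p := p) r (iterate p G j).1 (iterate p G j).2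
      refine ⟨w, m + 1 + 1, 1, m + 1 + 1 + 1 + 1, ?_, Or.inl
        ⟨le_of_negCurv h hp hG (by omega) hd hs hn hw1 hw2, by omega, by omega, by omega⟩⟩
      refine fun k => Runs.value (Runs.value (Runs.pullGrad ?_))
      refine Runs.ite_pos (by exact hn) ?_
      exact hruns k
    · have hd' : Descends p (O.value x) G (j + 1) := by
        intro i hi
        rcases Nat.lt_succ_iff_lt_or_eq.1 hi with hi | rfl
        · exact hd i hi
        · exact ⟨hn, hs⟩
      by_cases hterm : p.b < ‖(iterate p G (j + 1)).1‖ ∨ ‖G (iterate p G (j + 1)).1‖ ≤ p.eps / 2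
      · refine ⟨(iterate p G (j + 1)).1, 2, 2, 5, ?_, ?_⟩
        · refine fun k => Runs.value (Runs.value (Runs.pullGrad (nr := 2) ?_))
          refine Runs.ite_neg (by exact hn) ?_
          refine Runs.pullGrad (nr := 1) ?_
          refine Runs.ite_pos (by exact hterm) ?_
          exact (Runs.refl O _).retract
        · rcases hterm with hb | hsmall
          · exact Or.inl ⟨le_of_lt_norm_iterate h hp hG (by omega) hd' hb, by omega, by omega, by omega⟩
          -- A small gradient found after the first half counts as a decrease, because the first
          -- half produced only large ones.
          · rcases le_or_gt (j + 1) (p.steps / 2) with hjs | hjs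
            · refine Or.inr ⟨?_, norm_stepPair_le h hp hG hs, hsmall, by omega, by omega,
                by omega⟩
              refine (apply_le_energy hp.ell_pos _).trans
                ((energy_le h hp hG (Nat.zero_le _) hd').trans ?_)
              simp [energy, iterate]
            · exact Or.inl ⟨hhalf (j + 1) (by omega) hd' fun i hi => hlarge i (by omega),
                by omega, by omega, by omega⟩
      · obtain ⟨hb, hgrad⟩ := not_or.1 hterm
        obtain ⟨w, nv, ng, nr, hruns, hcase⟩ := ih (j + 1) (by omega) hd' (not_lt.1 hb)
          (fun i hi => by
            rcases Nat.lt_succ_iff_lt_or_eq.1 hi with hi | rfl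
            · exact hlarge i hi
            · exact not_le.1 hgrad)
        refine ⟨w, nv + 1 + 1, ng + 1 + 1, nr + 1 + 1 + 1 + 1, ?_, ?_⟩
        · refine fun k => Runs.value (Runs.value (Runs.pullGrad ?_))
          refine Runs.ite_neg (by exact hn) ?_
          refine Runs.pullGrad ?_
          refine Runs.ite_neg (by exact hterm) ?_
          exact hruns k
        · rcases hcase with ⟨h1, h2, h3, h4⟩ | ⟨h1, h2, h3, h4, h5, h6⟩
          · exact Or.inl ⟨h1, by omega, by omega, by omega⟩
          · exact Or.inr ⟨h1, h2, h3, by omega, by omega, by omega⟩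

/-- A run of tangent space steps either decreases the function or finds, in half of the steps, a
point where the gradient of the pullback is small. -/
lemma tss_runs (α : Type*) [FiniteDimensional ℝ (T x)] [CompleteSpace (T x)]
    {H : T x → T x →L[ℝ] T x} {rho l Δ : ℝ}
    (h : Landscape (O.value x) (O.pullGrad x) H p.ell rho p.b) (hp : Scales p l rho Δ)
    (hG : ‖O.pullGrad x 0‖ ≤ p.ell * p.theta * l / 100) (r : ArgminRule) :
    ∃ (w : T x) (nv ng nr : ℕ),
      (∀ k : M → Prog M T α, Runs O (tss p r x k) (k (O.retract x w)) nv ng nr) ∧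
      ((O.value x w ≤ O.value x 0 - Δ ∧ nv ≤ 2 * p.steps + 3 ∧ ng ≤ 2 * p.steps ∧
          nr ≤ 4 * p.steps + 4) ∨
        (O.value x w ≤ O.value x 0 ∧ ‖w‖ ≤ 3 * p.b ∧ ‖O.pullGrad x w‖ ≤ p.eps / 2 ∧
          nv ≤ p.steps ∧ ng ≤ p.steps ∧ nr ≤ 2 * p.steps + 1)) := by
  have := tssLoop_runs α h hp hG r p.steps 0 (by omega) (fun i hi => absurd hi (by omega))
    (by simpa [iterate] using (hp.r_pos.trans_le hp.r_le).le) (fun i hi => absurd hi (by omega))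
  simpa [tss, iterate] using this

end Loop

/-! ## Gradients and Hessians of pullbacks -/

section Calculus

variable {V : Type*} [NormedAddCommGroup V] [InnerProductSpace ℝ V] [CompleteSpace V] {F : V → ℝ}

lemma differentiable_gradient (hF : ContDiff ℝ 2 F) : Differentiable ℝ (gradient F) := by
  have h1 : Differentiable ℝ (fderiv ℝ F) :=
    (hF.fderiv_right (m := 1) (by norm_num)).differentiable (by norm_num)
  exact ((InnerProductSpace.toDual ℝ V).symm.toContinuousLinearEquiv.differentiable).comp h1

/-- The Riesz isomorphism turns this into the symmetry of the second derivative of `F`. -/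
lemma isSymmetric_fderiv_gradient (hF : ContDiff ℝ 2 F) (x : V) :
    (fderiv ℝ (gradient F) x).toLinearMap.IsSymmetric := by
  have h1 : DifferentiableAt ℝ (fderiv ℝ F) x :=
    ((hF.fderiv_right (m := 1) (by norm_num)).differentiable (by norm_num)) x
  have key : ∀ u w : V, inner ℝ (fderiv ℝ (gradient F) x u) w = fderiv ℝ (fderiv ℝ F) x u w := by
    intro u w
    have h2 : HasFDerivAt (fun y => fderiv ℝ F y w)
        ((ContinuousLinearMap.apply ℝ ℝ w).comp (fderiv ℝ (fderiv ℝ F) x)) x :=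
      (ContinuousLinearMap.apply ℝ ℝ w).hasFDerivAt.comp x h1.hasFDerivAt
    have h3 : HasFDerivAt (fun y => inner ℝ w (gradient F y))
        ((innerSL ℝ w).comp (fderiv ℝ (gradient F) x)) x :=
      (innerSL ℝ w).hasFDerivAt.comp x (differentiable_gradient hF x).hasFDerivAt
    have h4 : (fun y => fderiv ℝ F y w) = fun y => inner ℝ w (gradient F y) := by
      funext y
      rw [real_inner_comm, inner_gradient_left]
    rw [h4] at h2
    have h5 := congrArg (fun L => L u) (h3.unique h2)
    simpa [real_inner_comm] using h5
  have hsymm := hF.contDiffAt.isSymmSndFDerivAt (x := x) (by simp)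
  intro u w
  have h6 := hsymm.eq u w
  change inner ℝ (fderiv ℝ (gradient F) x u) w = inner ℝ u (fderiv ℝ (gradient F) x w)
  rw [real_inner_comm (fderiv ℝ (gradient F) x w) u, key, key, h6]

end Calculus

lemma hasFDerivAt_smul_const {V : Type*} [NormedAddCommGroup V] [NormedSpace ℝ V] (u : V) :
    HasFDerivAt (fun t : ℝ => t • u) (ContinuousLinearMap.toSpanSingleton ℝ u) 0 :=
  (ContinuousLinearMap.toSpanSingleton ℝ u).hasFDerivAt

lemma mfderiv_smul_const_apply_one {V : Type*} [NormedAddCommGroup V] [NormedSpace ℝ V] (u : V) :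
    (mfderiv 𝓘(ℝ, ℝ) 𝓘(ℝ, V) (fun t : ℝ => t • u) 0 (1 : ℝ) : V) = u := by
  rw [mfderiv_eq_fderiv, (hasFDerivAt_smul_const u).fderiv]
  exact one_smul ℝ u

section Geometry

variable {E : Type*} [NormedAddCommGroup E] [NormedSpace ℝ E]
  {M : Type*} [TopologicalSpace M] [ChartedSpace E M]
  {R : TangentBundle 𝓘(ℝ, E) M → M} {f : M → ℝ}

lemma pullback_zero [IsManifold 𝓘(ℝ, E) ∞ M] (hR : IsRetraction R) (x : M) :
    pullback f R x 0 = f x :=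
  congrArg f (hR.map_zero x)

variable [RiemannianBundle (fun x : M => TangentSpace 𝓘(ℝ, E) x)]

section

variable [IsManifold 𝓘(ℝ, E) ∞ M]

/-- The inclusion of a tangent space in the tangent bundle is smooth. -/
lemma contMDiff_tangentSpace_mk (x : M) :
    ContMDiff 𝓘(ℝ, TangentSpace 𝓘(ℝ, E) x) 𝓘(ℝ, E).tangent ∞
      (fun s : TangentSpace 𝓘(ℝ, E) x => (⟨x, s⟩ : TangentBundle 𝓘(ℝ, E) M)) := by
  intro s
  rw [contMDiffAt_totalSpace]
  refine ⟨contMDiffAt_const, ?_⟩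
  have h1 : (fun u : TangentSpace 𝓘(ℝ, E) x =>
      (trivializationAt E (TangentSpace 𝓘(ℝ, E)) x ⟨x, u⟩).2)
      = fun u => (trivializationAt E (TangentSpace 𝓘(ℝ, E)) x).continuousLinearMapAt ℝ x u := by
    funext u
    rw [Trivialization.continuousLinearMapAt_apply, Trivialization.linearMapAt_apply,
      if_pos (mem_baseSet_trivializationAt E _ x)]
  change ContMDiffAt _ _ _ (fun u : TangentSpace 𝓘(ℝ, E) x =>
      (trivializationAt E (TangentSpace 𝓘(ℝ, E)) x ⟨x, u⟩).2) s
  rw [h1]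
  exact ((trivializationAt E (TangentSpace 𝓘(ℝ, E)) x).continuousLinearMapAt ℝ x).contDiff.contMDiff.contMDiffAt

lemma contMDiff_retract (hR : IsRetraction R) (x : M) :
    ContMDiff 𝓘(ℝ, TangentSpace 𝓘(ℝ, E) x) 𝓘(ℝ, E) ∞
      (fun s : TangentSpace 𝓘(ℝ, E) x => R ⟨x, s⟩) :=
  hR.contMDiff.comp (contMDiff_tangentSpace_mk x)

lemma contDiff_pullback (hR : IsRetraction R) (hf : ContMDiff 𝓘(ℝ, E) 𝓘(ℝ, ℝ) 2 f) (x : M) :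
    ContDiff ℝ 2 (pullback f R x) := by
  rw [← contMDiff_iff_contDiff]
  exact hf.comp ((contMDiff_retract hR x).of_le (by norm_cast))

/-- The velocity condition together with the chain rule along `t ↦ t • u`. -/
lemma retractionDeriv_zero (hR : IsRetraction R) (x : M) (u : TangentSpace 𝓘(ℝ, E) x) :
    (retractionDeriv R x 0 u : E) = u := by
  have h1 := mfderiv_comp_of_eq (I := 𝓘(ℝ, ℝ)) (I' := 𝓘(ℝ, TangentSpace 𝓘(ℝ, E) x))
    (I'' := 𝓘(ℝ, E)) (x := (0 : ℝ)) (y := (0 : TangentSpace 𝓘(ℝ, E) x))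
    (g := fun s : TangentSpace 𝓘(ℝ, E) x => R ⟨x, s⟩) (f := fun t : ℝ => t • u)
    ((contMDiff_retract hR x 0).mdifferentiableAt (by simp))
    (hasFDerivAt_smul_const u).differentiableAt.mdifferentiableAt (zero_smul ℝ u)
  have h4 : (mfderiv 𝓘(ℝ, ℝ) 𝓘(ℝ, E) (fun t : ℝ => R ⟨x, t • u⟩) 0 (1 : ℝ) : E)
      = retractionDeriv R x ((0 : ℝ) • u)
        (mfderiv 𝓘(ℝ, ℝ) 𝓘(ℝ, TangentSpace 𝓘(ℝ, E) x) (fun t : ℝ => t • u) 0 (1 : ℝ)) :=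
    congrArg (fun L : ℝ →L[ℝ] E => L 1) h1
  have h5 : ∀ w z : TangentSpace 𝓘(ℝ, E) x, w = 0 → z = u →
      (retractionDeriv R x w z : E) = (retractionDeriv R x 0 u : E) := by
    rintro w z rfl rfl
    rfl
  exact (h5 _ _ (zero_smul ℝ u) (mfderiv_smul_const_apply_one u)).symm.trans
    (h4.symm.trans (hR.velocity x u))

end

variable [FiniteDimensional ℝ E]

instance finiteDimensional_tangentSpace (x : M) :
    FiniteDimensional ℝ (TangentSpace 𝓘(ℝ, E) x) :=
  inferInstanceAs (FiniteDimensional ℝ E)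

lemma inner_rgrad (y : M) (w : TangentSpace 𝓘(ℝ, E) y) :
    inner ℝ (rgrad (E := E) f y) w = (mfderiv 𝓘(ℝ, E) 𝓘(ℝ, ℝ) f y w : ℝ) :=
  InnerProductSpace.toDual_symm_apply

variable [IsManifold 𝓘(ℝ, E) ∞ M]

/-- The chain rule for pullbacks. -/
lemma inner_pgrad (hR : IsRetraction R) (hf : ContMDiff 𝓘(ℝ, E) 𝓘(ℝ, ℝ) 2 f) (x : M)
    (s u : TangentSpace 𝓘(ℝ, E) x) :
    inner ℝ (pgrad f R x s) u = inner ℝ (rgrad (E := E) f (R ⟨x, s⟩)) (retractionDeriv R x s u) := by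
  have h1 : inner ℝ (pgrad f R x s) u = fderiv ℝ (pullback f R x) s u := inner_gradient_left
  have h2 := mfderiv_comp (I := 𝓘(ℝ, TangentSpace 𝓘(ℝ, E) x)) (I' := 𝓘(ℝ, E)) (I'' := 𝓘(ℝ, ℝ)) s
    (g := f) (f := fun s : TangentSpace 𝓘(ℝ, E) x => R ⟨x, s⟩)
    ((hf _).mdifferentiableAt (by norm_num))
    ((contMDiff_retract hR x s).mdifferentiableAt (by simp))
  rw [h1, ← mfderiv_eq_fderiv]
  have h3 : (mfderiv 𝓘(ℝ, TangentSpace 𝓘(ℝ, E) x) 𝓘(ℝ, ℝ) (pullback f R x) s : _) = _ := h2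
  rw [h3]
  exact (inner_rgrad _ _).symm

lemma pgrad_zero (hR : IsRetraction R) (hf : ContMDiff 𝓘(ℝ, E) 𝓘(ℝ, ℝ) 2 f) (x : M) :
    pgrad f R x 0 = rgrad (E := E) f x := by
  refine ext_inner_right ℝ fun u => ?_
  rw [inner_pgrad hR hf x 0 u, inner_rgrad, inner_rgrad]
  -- The base points `R ⟨x, 0⟩` and `x` are only propositionally equal. Reading tangent vectors in
  -- `E` allows substitution for the point.
  have key : ∀ (y : M) (w : E), y = x → w = u →
      ((mfderiv 𝓘(ℝ, E) 𝓘(ℝ, ℝ) f y : E →L[ℝ] ℝ) w : ℝ)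
        = (mfderiv 𝓘(ℝ, E) 𝓘(ℝ, ℝ) f x : E →L[ℝ] ℝ) u := by
    rintro y w rfl rfl
    rfl
  exact key _ _ (hR.map_zero x) (retractionDeriv_zero hR x u)

/-- In equal dimensions the singular value bound makes the differential of the retraction
surjective. Pairing the pullback gradient with a preimage `u` of the Riemannian gradient gives `g² ≤
‖pgrad‖ ‖u‖`, where `‖u‖ ≤ 2g`. -/
lemma norm_rgrad_le {flow ell rho b : ℝ} (hR : IsRetraction R)
    (hA : PullbackAssumptions f R flow ell rho b) {x : M}
    (hx : ‖rgrad (E := E) f x‖ ≤ 1 / 2 * ell * b) {s : TangentSpace 𝓘(ℝ, E) x}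
    (hs : ‖s‖ ≤ 3 * b) : ‖rgrad (E := E) f (R ⟨x, s⟩)‖ ≤ 2 * ‖pgrad f R x s‖ := by
  have hσ := hA.hsigma x hx s hs
  have hinj : Function.Injective (retractionDeriv R x s) := by
    rw [injective_iff_map_eq_zero]
    intro u hu
    have := hσ u
    rw [hu, norm_zero] at this
    exact norm_le_zero_iff.1 (by linarith)
  have hdim : Module.finrank ℝ (TangentSpace 𝓘(ℝ, E) x)
      = Module.finrank ℝ (TangentSpace 𝓘(ℝ, E) (R ⟨x, s⟩)) := rfl
  obtain ⟨u, hu⟩ := (LinearMap.injective_iff_surjective_of_finrank_eq_finrank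
    (f := (retractionDeriv R x s).toLinearMap) hdim).1 hinj (rgrad (E := E) f (R ⟨x, s⟩))
  have hu' : retractionDeriv R x s u = rgrad (E := E) f (R ⟨x, s⟩) := hu
  have h1 := inner_pgrad hR hA.hC2 x s u
  rw [hu', real_inner_self_eq_norm_sq] at h1
  have h2 := hσ u
  rw [hu'] at h2
  have h3 := real_inner_le_norm (pgrad f R x s) u
  set g := ‖rgrad (E := E) f (R ⟨x, s⟩)‖
  rcases (norm_nonneg (rgrad (E := E) f (R ⟨x, s⟩))).eq_or_lt' with h0 | h0
  · have : g = 0 := h0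
    rw [this]; positivity
  · have h4 : ‖pgrad f R x s‖ * ‖u‖ ≤ ‖pgrad f R x s‖ * (2 * g) :=
      mul_le_mul_of_nonneg_left (by linarith) (norm_nonneg _)
    refine le_of_mul_le_mul_right ?_ (show 0 < g from h0)
    nlinarith

lemma landscape_pullback {flow ell rho b : ℝ} (hR : IsRetraction R)
    (hA : PullbackAssumptions f R flow ell rho b) {x : M}
    (hx : ‖rgrad (E := E) f x‖ ≤ 1 / 2 * ell * b) :
    Landscape (pullback f R x) (pgrad f R x) (phess f R x) ell rho b := by
  have hC := contDiff_pullback hR hA.hC2 x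
  exact
    { grad := fun s => (hC.differentiable (by norm_num) s).hasGradientAt
      hess := fun s => (differentiable_gradient hC s).hasFDerivAt
      symm := isSymmetric_fderiv_gradient hC 0
      lip := fun s s' hs hs' => hA.hgrad x hx s s' hs hs'
      hess_sub := fun s hs => hA.hhess x hx s hs }

end Geometry

/-! ## The parameters -/

section Parameters

variable {ell rho b eps c χ : ℝ} {steps : ℕ}

lemma sqrt_mul_eq (hrho : 0 < rho) : √(rho * eps) = rho * √(eps / rho) := by
  rw [show rho * eps = rho ^ 2 * (eps / rho) by field_simp, Real.sqrt_mul (by positivity),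
    Real.sqrt_sq hrho.le]

lemma mul_sqrt_div_eq (hrho : 0 < rho) (heps : 0 < eps) :
    √(rho * eps) * √(eps / rho) = eps := by
  rw [sqrt_mul_eq hrho, mul_assoc, Real.mul_self_sqrt (by positivity)]
  field_simp

lemma theta_pos (hell : 0 < ell) (hrho : 0 < rho) (heps : 0 < eps) : 0 < theta ell rho eps := by
  unfold theta kappa
  positivity

lemma sqrt_kappa_eq (hell : 0 < ell) (hrho : 0 < rho) (heps : 0 < eps) :
    √(kappa ell rho eps) = 1 / (4 * theta ell rho eps) := by
  have : 0 < √(kappa ell rho eps) := by unfold kappa; positivity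
  unfold theta
  field_simp

/-- Since `θ² = 1/(16κ)`. This, with `r = √(ε/ρ)`, expresses all parameters through `ℓ`, `θ` and
`r`. -/
lemma sqrt_eq_theta (hell : 0 < ell) (hrho : 0 < rho) (heps : 0 < eps) :
    √(rho * eps) = 16 * ell * theta ell rho eps ^ 2 := by
  have h0 : 0 < √(rho * eps) := by positivity
  have h1 : √(kappa ell rho eps) ^ 2 = ell / √(rho * eps) :=
    Real.sq_sqrt (by unfold kappa; positivity)
  unfold theta
  rw [div_pow, mul_pow, h1]
  field_simp
  norm_num

lemma theta_le (hell : 0 < ell) (hrho : 0 < rho) (heps : 0 < eps)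
    (h : √(rho * eps) ≤ 1 / 2 * ell) : theta ell rho eps ≤ 1 / 4 := by
  rw [sqrt_eq_theta hell hrho heps] at h
  have h1 := theta_pos hell hrho heps
  have h2 : theta ell rho eps ^ 2 ≤ (1 / 4) ^ 2 := by
    refine le_of_mul_le_mul_left ?_ hell
    linarith
  exact le_of_sq_le_sq h2 (by norm_num)

lemma bigE_eq (hell : 0 < ell) (hrho : 0 < rho) (heps : 0 < eps) :
    bigE rho eps χ c
      = 16 * ell * theta ell rho eps ^ 2 * √(eps / rho) ^ 2 / (χ ^ 5 * c ^ 7) := by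
  have h1 : √(eps ^ 3 / rho) = eps * √(eps / rho) := by
    rw [show eps ^ 3 / rho = eps ^ 2 * (eps / rho) by ring, Real.sqrt_mul (by positivity),
      Real.sqrt_sq heps.le]
  have h2 : eps = 16 * ell * theta ell rho eps ^ 2 * √(eps / rho) := by
    rw [← sqrt_eq_theta hell hrho heps, mul_sqrt_div_eq hrho heps]
  unfold bigE
  rw [h1]
  calc eps * √(eps / rho) * (χ ^ 5)⁻¹ * (c ^ 7)⁻¹
      = (16 * ell * theta ell rho eps ^ 2 * √(eps / rho)) * √(eps / rho)
          * (χ ^ 5)⁻¹ * (c ^ 7)⁻¹ := by rw [← h2]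
    _ = _ := by rw [div_eq_mul_inv _ (χ ^ 5 * c ^ 7), mul_inv]; ring

lemma threshold_eq (hell : 0 < ell) (hrho : 0 < rho) (heps : 0 < eps) :
    2 * (params ell rho b eps c steps).ell * (params ell rho b eps c steps).bigM
      = 8 * ell * theta ell rho eps * √(eps / rho) / c := by
  have h2 : eps = 16 * ell * theta ell rho eps ^ 2 * √(eps / rho) := by
    rw [← sqrt_eq_theta hell hrho heps, mul_sqrt_div_eq hrho heps]
  have hth := theta_pos hell hrho heps
  simp only [params]
  rw [sqrt_kappa_eq hell hrho heps]
  calc 2 * ell * (eps * (1 / (4 * theta ell rho eps)) / ell * c⁻¹)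
      = 2 * ell * ((16 * ell * theta ell rho eps ^ 2 * √(eps / rho))
          * (1 / (4 * theta ell rho eps)) / ell * c⁻¹) := by rw [← h2]
    _ = _ := by field_simp; ring

lemma two_le_chi (hell : 0 < ell) (hrho : 0 < rho) (heps : 0 < eps)
    (h : √(rho * eps) ≤ 1 / 2 * ell) (hχ : Real.logb 2 (theta ell rho eps)⁻¹ ≤ χ) : 2 ≤ χ := by
  refine le_trans ?_ hχ
  have h1 := theta_pos hell hrho heps
  rw [Real.le_logb_iff_rpow_le (by norm_num) (by positivity), le_inv_comm₀ (by positivity) h1]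
  refine (theta_le hell hrho heps h).trans ?_
  norm_num

lemma scales_params (hell : 0 < ell) (hrho : 0 < rho) (hb : 0 < b) (heps : 0 < eps)
    (h : √(rho * eps) ≤ 1 / 2 * ell) (hepsb : eps ≤ b ^ 2 * rho) (hc : 1000 ≤ c)
    (hχ : Real.logb 2 (theta ell rho eps)⁻¹ ≤ χ)
    (hsteps : (steps : ℝ) = √(kappa ell rho eps) * χ * c) (hdvd : 4 ∣ steps) :
    Scales (params ell rho b eps c steps) √(eps / rho) rho (2 * bigE rho eps χ c) := by
  have hth := theta_pos hell hrho heps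
  have hth' := theta_le hell hrho heps h
  have hχ2 := two_le_chi hell hrho heps h hχ
  have hr : 0 < √(eps / rho) := by positivity
  have hE := bigE_eq (χ := χ) (c := c) hell hrho heps
  have hd := sqrt_eq_theta hell hrho heps
  rw [sqrt_kappa_eq hell hrho heps] at hsteps
  have hrd := sqrt_mul_eq (eps := eps) hrho
  have hreps := mul_sqrt_div_eq hrho heps
  set θ := theta ell rho eps with hθ
  set l := √(eps / rho) with hl
  have hχ0 : 0 < χ := by linarith
  have hc0 : 0 < c := by linarith
  have hχ1 : 1 ≤ χ := by linarith
  have hX : θ * steps = χ * c / 4 := by rw [hsteps]; field_simp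
  have hXc : 2 * 1000 ≤ χ * c := mul_le_mul hχ2 hc (by norm_num) hχ0.le
  have hE0 : 0 < bigE rho eps χ c := by rw [hE]; positivity
  refine
    { ell_pos := hell
      eta_eq := rfl
      theta_pos := hth
      theta_le := hth'
      gamma_eq := ?_
      sbar_eq := ?_
      eps_eq := ?_
      rho_pos := hrho
      rho_mul := ?_
      r_pos := hr
      r_le := ?_
      decrease_pos := by linarith
      steps_mul_decrease := ?_
      decrease_le := ?_
      four_dvd := hdvd
      steps_mul_theta := ?_
      exp_le := ?_ }
  · simp only [params]; rw [hd]; ring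
  · simp only [params]; ring
  · rw [hd] at hreps
    exact hreps.symm
  · simp only [params]; rw [← hrd, hd]
  · simp only [params]
    refine Real.sqrt_le_iff.2 ⟨hb.le, ?_⟩
    rwa [div_le_iff₀ hrho]
  · simp only [params]
    rw [hsteps, hE]
    have h1 : 1 / (4 * θ) * χ * c * (2 * (16 * ell * θ ^ 2 * l ^ 2 / (χ ^ 5 * c ^ 7)))
        = ell * θ * l ^ 2 * (8 / (χ ^ 4 * c ^ 6)) := by field_simp; ring
    have h2 : 8 / (χ ^ 4 * c ^ 6) ≤ 1 / 10 ^ 12 := by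
      have h3 : 1 * (1000 : ℝ) ^ 6 ≤ χ ^ 4 * c ^ 6 := by
        gcongr
        exact one_le_pow₀ hχ1
      rw [div_le_div_iff₀ (by positivity) (by norm_num)]
      linarith
    rw [h1]
    calc ell * θ * l ^ 2 * (8 / (χ ^ 4 * c ^ 6)) ≤ ell * θ * l ^ 2 * (1 / 10 ^ 12) := by gcongr
      _ = _ := by ring
  · simp only [params]
    rw [hE]
    have h2 : 32 / (χ ^ 5 * c ^ 7) ≤ 1 / 10 ^ 6 := by
      have h3 : 1 * (1000 : ℝ) ^ 7 ≤ χ ^ 5 * c ^ 7 := by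
        gcongr
        exact one_le_pow₀ hχ1
      rw [div_le_div_iff₀ (by positivity) (by norm_num)]
      linarith
    calc 2 * (16 * ell * θ ^ 2 * l ^ 2 / (χ ^ 5 * c ^ 7))
        = ell * θ ^ 2 * l ^ 2 * (32 / (χ ^ 5 * c ^ 7)) := by ring
      _ ≤ ell * θ ^ 2 * l ^ 2 * (1 / 10 ^ 6) := by gcongr
      _ = _ := by ring
  · simp only [params]
    linarith
  · simp only [params]
    rw [← hθ, hX]
    -- The one place where the logarithmic lower bound on `χ` is used in full: the exponent is
    -- `χc/32`, and it has to dominate `2 log θ⁻¹`.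
    have h1 : Real.log θ⁻¹ ≤ χ := by
      have h2 : Real.log 2 ≤ 1 := by linarith [Real.log_two_lt_d9]
      have h3 : 0 < Real.log 2 := Real.log_pos (by norm_num)
      rw [Real.logb, div_le_iff₀ h3] at hχ
      exact hχ.trans (mul_le_of_le_one_right hχ0.le h2)
    have h4 : θ ^ 2 = Real.exp (-(2 * Real.log θ⁻¹)) := by
      rw [Real.log_inv, mul_neg, neg_neg, two_mul, Real.exp_add, Real.exp_log hth, sq]
    rw [h4]
    apply Real.exp_le_exp.2
    have h5 : χ * 1000 ≤ χ * c := mul_le_mul_of_nonneg_left hc hχ0.le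
    linarith

end Parameters

/-! ## The outer loop -/

section OuterLoop

variable {E : Type*} [NormedAddCommGroup E] [NormedSpace ℝ E] [FiniteDimensional ℝ E]
  {M : Type*} [TopologicalSpace M] [ChartedSpace E M] [IsManifold 𝓘(ℝ, E) ∞ M]
  [RiemannianBundle (fun x : M => TangentSpace 𝓘(ℝ, E) x)]
  {R : TangentBundle 𝓘(ℝ, E) M → M} {f : M → ℝ} {flow rho l Δ : ℝ} {p : Params}

/-- A gradient step decreases the function. -/
lemma le_of_gradient_step (hR : IsRetraction R) (hA : PullbackAssumptions f R flow p.ell rho p.b)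
    (hp : Scales p l rho Δ) (hΔ : Δ ≤ p.ell * p.bigM ^ 2 / 2) (hM : 0 ≤ p.bigM) {x : M}
    (hx : 2 * p.ell * p.bigM < ‖rgrad (E := E) f x‖) :
    f (R ⟨x, -(p.eta • rgrad (E := E) f x)⟩) ≤ f x - Δ := by
  have h1 := hA.hquad x (-(p.eta • rgrad (E := E) f x))
  rw [pullback_zero hR, pgrad_zero hR hA.hC2, inner_neg_right, inner_smul_right,
    real_inner_self_eq_norm_sq, norm_neg, norm_smul, mul_pow, Real.norm_eq_abs, sq_abs] at h1
  have hell := hp.ell_pos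
  have h2 : (2 * p.ell * p.bigM) ^ 2 ≤ ‖rgrad (E := E) f x‖ ^ 2 :=
    pow_le_pow_left₀ (by positivity) hx.le 2
  have h3 : p.ell * p.eta = 1 / 4 := by rw [hp.eta_eq]; field_simp
  have heta : 0 < p.eta := by rw [hp.eta_eq]; positivity
  set g := ‖rgrad (E := E) f x‖
  have h4 : p.ell / 2 * (p.eta ^ 2 * g ^ 2) = p.eta * g ^ 2 / 8 := by
    linear_combination p.eta * g ^ 2 / 2 * h3
  have h5 := mul_le_mul_of_nonneg_left h2 heta.le
  have h6 : p.eta * (2 * p.ell * p.bigM) ^ 2 = p.ell * p.bigM ^ 2 := by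
    linear_combination 4 * p.ell * p.bigM ^ 2 * h3
  have h7 : pullback f R x (-(p.eta • rgrad (E := E) f x))
    = f (R ⟨x, -(p.eta • rgrad (E := E) f x)⟩) := rfl
  have h8 : 0 ≤ p.ell * p.bigM ^ 2 := by positivity
  linarith

/-- One round of the algorithm which does not return. -/
lemma tagd_round (hR : IsRetraction R) (hA : PullbackAssumptions f R flow p.ell rho p.b)
    (hp : Scales p l rho Δ) (hΔ : Δ ≤ p.ell * p.bigM ^ 2 / 2) (hM : 0 ≤ p.bigM)
    (hMl : 2 * p.ell * p.bigM ≤ p.ell * p.theta * l / 100) (r : ArgminRule) (x : M)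
    (hx : ¬ (‖rgrad (E := E) f x‖ ≤ 2 * p.ell * p.bigM ∧ ‖rgrad (E := E) f x‖ ≤ p.eps)) :
    ∃ (t' : ℕ) (x' : M) (nv ng nr : ℕ),
      (∀ n t, Runs (problemOracle f R)
        (tagd (T := fun x : M => TangentSpace 𝓘(ℝ, E) x) p r (n + 1) t x)
        (tagd p r n (t + t') x') nv ng nr) ∧
      t' ≤ p.steps ∧
      ((f x' ≤ f x - Δ ∧ nv ≤ 2 * p.steps + 3 ∧ ng ≤ 2 * p.steps + 1 ∧ nr ≤ 4 * p.steps + 4) ∨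
        (f x' ≤ f x ∧ ‖rgrad (E := E) f x'‖ ≤ 2 * p.ell * p.bigM ∧
          ‖rgrad (E := E) f x'‖ ≤ p.eps ∧ nv ≤ p.steps ∧ ng ≤ p.steps + 1 ∧
          nr ≤ 2 * p.steps + 1)) := by
  have hsteps : 0 < p.steps := by
    rcases Nat.eq_zero_or_pos p.steps with h0 | h0
    · have := hp.steps_mul_theta
      rw [h0] at this
      norm_num at this
    · exact h0
  by_cases h1 : 2 * p.ell * p.bigM < ‖rgrad (E := E) f x‖
  · refine ⟨1, R ⟨x, -(p.eta • rgrad (E := E) f x)⟩, 0, 1, 1, fun n t => ?_, by omega,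
      Or.inl ⟨le_of_gradient_step hR hA hp hΔ hM h1, by omega, by omega, by omega⟩⟩
    refine Runs.grad (ng := 0) (Runs.ite_pos (by exact h1) ?_)
    exact (Runs.refl _ _).retract
  · have h2 : p.eps < ‖rgrad (E := E) f x‖ := by
      by_contra h3
      exact hx ⟨not_lt.1 h1, not_lt.1 h3⟩
    have hsmall : ‖rgrad (E := E) f x‖ ≤ p.ell * p.theta * l / 100 := (not_lt.1 h1).trans hMl
    have hell := hp.ell_pos
    have hl := hp.r_pos
    have hxb : ‖rgrad (E := E) f x‖ ≤ 1 / 2 * p.ell * p.b := by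
      have h3 : p.theta * l ≤ 1 * p.b :=
        mul_le_mul (by linarith [hp.theta_le]) hp.r_le hl.le zero_le_one
      have h4 := mul_le_mul_of_nonneg_left h3 hell.le
      have h5 : 0 ≤ p.ell * p.b := (mul_pos hell (hl.trans_le hp.r_le)).le
      linarith
    obtain ⟨w, nv, ng, nr, hruns, hcase⟩ := tss_runs (Option (ℕ × M)) (O := problemOracle f R)
      (x := x) (landscape_pullback hR hA hxb) hp
      (by
        change ‖pgrad f R x 0‖ ≤ _
        rwa [pgrad_zero hR hA.hC2]) r
    have hw0 : pullback f R x 0 = f x := pullback_zero hR x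
    refine ⟨p.steps, R ⟨x, w⟩, nv, ng + 1, nr, fun n t => ?_, le_rfl, ?_⟩
    · refine Runs.grad (Runs.ite_neg (by exact h1) (Runs.ite_pos (by exact h2) ?_))
      exact hruns _
    · rcases hcase with ⟨h3, h4, h5, h6⟩ | ⟨h3, h4, h5, h6, h7, h8⟩
      · refine Or.inl ⟨?_, by omega, by omega, by omega⟩
        rw [← hw0]
        exact h3
      · have h9 : ‖rgrad (E := E) f (R ⟨x, w⟩)‖ ≤ p.eps := by
          have h10 := norm_rgrad_le hR hA hxb h4
          have h11 : ‖pgrad f R x w‖ ≤ p.eps / 2 := h5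
          linarith
        -- The new point also passes the first threshold: the old gradient lay between `ε` and
        -- `2ℓℳ`, so `ε < 2ℓℳ`.
        refine Or.inr ⟨?_, by linarith, h9, by omega, by omega, by omega⟩
        rw [← hw0]
        exact h3

/-- The run of the algorithm, in terms of the number `N` of times that the function can decrease
by `Δ`. -/
lemma tagd_runs (hR : IsRetraction R) (hA : PullbackAssumptions f R flow p.ell rho p.b)
    (hp : Scales p l rho Δ) (hΔ : Δ ≤ p.ell * p.bigM ^ 2 / 2) (hM : 0 ≤ p.bigM)
    (hMl : 2 * p.ell * p.bigM ≤ p.ell * p.theta * l / 100)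
    (r : ArgminRule) (N : ℕ) (t : ℕ) (x : M) (hN : f x - flow < (N + 1) * Δ) :
    ∃ (n t' : ℕ) (x' : M) (nv ng nr : ℕ),
      Runs (problemOracle f R) (tagd (T := fun x : M => TangentSpace 𝓘(ℝ, E) x) p r n t x)
        (.done (some (t + t', x'))) nv ng nr ∧
      f x' ≤ f x ∧ ‖rgrad (E := E) f x'‖ ≤ p.eps ∧
      t' ≤ p.steps * (N + 1) ∧ ng ≤ (2 * p.steps + 1) * N + (p.steps + 2) ∧
      nv ≤ (2 * p.steps + 3) * N + p.steps ∧ nr ≤ (4 * p.steps + 4) * N + (2 * p.steps + 1) := by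
  have hdone : ∀ (t : ℕ) (x : M), ‖rgrad (E := E) f x‖ ≤ 2 * p.ell * p.bigM →
      ‖rgrad (E := E) f x‖ ≤ p.eps →
      Runs (problemOracle f R) (tagd (T := fun x : M => TangentSpace 𝓘(ℝ, E) x) p r 1 t x)
        (.done (some (t, x))) 0 1 0 := by
    intro t x h1 h2
    refine Runs.grad (ng := 0) (Runs.ite_neg (by exact not_lt.2 h1)
      (Runs.ite_neg (by exact not_lt.2 h2) ?_))
    exact Runs.refl _ _
  induction N generalizing t x with
  | zero =>
    by_cases hx : ‖rgrad (E := E) f x‖ ≤ 2 * p.ell * p.bigM ∧ ‖rgrad (E := E) f x‖ ≤ p.eps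
    · exact ⟨1, 0, x, 0, 1, 0, hdone t x hx.1 hx.2, le_rfl, hx.2, by omega, by omega, by omega,
        by omega⟩
    obtain ⟨t', x', nv, ng, nr, hruns, ht', hcase⟩ := tagd_round hR hA hp hΔ hM hMl r x hx
    rcases hcase with ⟨h1, -⟩ | ⟨h1, h2, h3, h4, h5, h6⟩
    -- With less than `Δ` left above the lower bound, a decreasing round is impossible.
    · have := hA.hlow x'
      push_cast at hN
      linarith
    · exact ⟨2, t', x', _, _, _, (hruns 1 t).trans (hdone _ x' h2 h3), h1, h3, by omega, by omega,
        by omega, by omega⟩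
  | succ N ih =>
    by_cases hx : ‖rgrad (E := E) f x‖ ≤ 2 * p.ell * p.bigM ∧ ‖rgrad (E := E) f x‖ ≤ p.eps
    · exact ⟨1, 0, x, 0, 1, 0, hdone t x hx.1 hx.2, le_rfl, hx.2, by omega, by omega, by omega,
        by omega⟩
    obtain ⟨t', x', nv, ng, nr, hruns, ht', hcase⟩ := tagd_round hR hA hp hΔ hM hMl r x hx
    rcases hcase with ⟨h1, h2, h3, h4⟩ | ⟨h1, h2, h3, h4, h5, h6⟩
    · push_cast at hN
      obtain ⟨n, t₂, y, nv₂, ng₂, nr₂, hruns₂, g1, g2, g3, g4, g5, g6⟩ :=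
        ih (t + t') x' (by linarith)
      refine ⟨n + 1, t' + t₂, y, nv₂ + nv, ng₂ + ng, nr₂ + nr, ?_, ?_, g2, ?_, ?_, ?_, ?_⟩
      · rw [← add_assoc]
        exact (hruns n t).trans hruns₂
      · linarith [hp.decrease_pos]
      all_goals
        simp only [Nat.mul_add, mul_one] at *
        omega
    · refine ⟨2, t', x', _, _, _, (hruns 1 t).trans (hdone _ x' h2 h3), h1, h3, ?_, ?_, ?_, ?_⟩
      all_goals
        simp only [Nat.mul_add, mul_one] at *
        omega

end OuterLoop

end TAGD

theorem mainTheorem4 :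
    ∃ c₀ : ℝ, 0 < c₀ ∧ ∀ c : ℝ, c₀ ≤ c →
      ∀ (E : Type*) [NormedAddCommGroup E] [NormedSpace ℝ E] [FiniteDimensional ℝ E]
        (M : Type*) [TopologicalSpace M] [ChartedSpace E M] [IsManifold 𝓘(ℝ, E) ∞ M]
        [RiemannianBundle (fun x : M => TangentSpace 𝓘(ℝ, E) x)]
        [IsContMDiffRiemannianBundle 𝓘(ℝ, E) ∞ E (fun x : M => TangentSpace 𝓘(ℝ, E) x)]
        (R : TangentBundle 𝓘(ℝ, E) M → M) (f : M → ℝ)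
        (flow ell rho b eps χ : ℝ) (steps : ℕ) (r : TAGD.ArgminRule) (x₀ : M),
        TAGD.IsRetraction R →
        TAGD.PullbackAssumptions f R flow ell rho b →
        0 < ell → 0 < rho → 0 < b → 0 < eps →
        √(rho * eps) ≤ 1 / 2 * ell → eps ≤ b ^ 2 * rho →
        Real.logb 2 (TAGD.theta ell rho eps)⁻¹ ≤ χ →
        (steps : ℝ) = √(TAGD.kappa ell rho eps) * χ * c → 0 < steps → 4 ∣ steps →
        ∃ (n t : ℕ) (x : M),
          let prog := TAGD.tagd (T := fun x : M => TangentSpace 𝓘(ℝ, E) x)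
            (TAGD.params ell rho b eps c steps) r n 0 x₀
          let O := TAGD.problemOracle f R
          let T₁ : ℝ := max ((f x₀ - flow) / TAGD.bigE rho eps χ c) 1 * steps
          prog.output O = some (t, x) ∧
          f x ≤ f x₀ ∧
          ‖TAGD.rgrad (E := E) f x‖ ≤ eps ∧
          (t : ℝ) ≤ T₁ ∧
          (prog.gradQueries O : ℝ) ≤ 2 * T₁ ∧
          (prog.valueQueries O : ℝ) ≤ 3 * T₁ ∧
          (prog.retractCalls O : ℝ) ≤ 6 * T₁ := by
  -- The most demanding use of `c₀` is `8/c ≤ 1/100`, which makes the initial gradient in a tangent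
  -- space small enough.
  refine ⟨1000, by norm_num, ?_⟩
  intro c hc E _ _ _ M _ _ _ _ _ R f flow ell rho b eps χ steps r x₀ hR hA hell hrho hb heps h
    hepsb hχ hsteps hpos hdvd
  have hp := TAGD.scales_params hell hrho hb heps h hepsb hc hχ hsteps hdvd
  have hthr := TAGD.threshold_eq (b := b) (c := c) (steps := steps) hell hrho heps
  have hth := TAGD.theta_pos hell hrho heps
  have hχ2 := TAGD.two_le_chi hell hrho heps h hχ
  have hE := TAGD.bigE_eq (χ := χ) (c := c) hell hrho heps
  have hΔ0 := hp.decrease_pos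
  set p := TAGD.params ell rho b eps c steps with hp_def
  set Δ := 2 * TAGD.bigE rho eps χ c with hΔ_def
  set θ := TAGD.theta ell rho eps with hθ
  set l := √(eps / rho) with hl
  have hl0 : 0 < l := hp.r_pos
  have hc0 : 0 < c := by linarith
  have hM : p.bigM = 4 * θ * l / c := by
    have h1 : 2 * ell * p.bigM = 8 * ell * θ * l / c := hthr
    have h2 : 2 * ell * p.bigM = 2 * ell * (4 * θ * l / c) := by rw [h1]; ring
    exact mul_left_cancel₀ (by positivity) h2
  have hM0 : 0 ≤ p.bigM := by rw [hM]; positivity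
  have hMl : 2 * p.ell * p.bigM ≤ p.ell * p.theta * l / 100 := by
    rw [hthr, div_le_iff₀ hc0]
    have h1 : p.ell * p.theta = ell * θ := rfl
    rw [h1]
    have h2 : 0 < ell * θ * l := by positivity
    have h3 := mul_le_mul_of_nonneg_left hc h2.le
    linarith
  have hΔ : Δ ≤ p.ell * p.bigM ^ 2 / 2 := by
    have h1 : p.ell = ell := rfl
    rw [hΔ_def, hE, hM, h1]
    have h2 : 4 ≤ χ ^ 5 * c ^ 5 := by
      have h3 : (2 : ℝ) ^ 5 * 1000 ^ 5 ≤ χ ^ 5 * c ^ 5 := by gcongr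
      linarith
    have h4 : ell * (4 * θ * l / c) ^ 2 / 2
        - 2 * (16 * ell * θ ^ 2 * l ^ 2 / (χ ^ 5 * c ^ 7))
        = 8 * ell * θ ^ 2 * l ^ 2 / (χ ^ 5 * c ^ 7) * (χ ^ 5 * c ^ 5 - 4) := by
      have : 0 < χ := by linarith
      field_simp
      ring
    have h5 : 0 ≤ 8 * ell * θ ^ 2 * l ^ 2 / (χ ^ 5 * c ^ 7) * (χ ^ 5 * c ^ 5 - 4) := by
      have : 0 < χ := by linarith
      exact mul_nonneg (by positivity) (by linarith)
    linarith
  set N := ⌊(f x₀ - flow) / Δ⌋₊ with hN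
  have hgap : 0 ≤ f x₀ - flow := sub_nonneg.2 (hA.hlow x₀)
  have hN1 : f x₀ - flow < (N + 1) * Δ := (div_lt_iff₀ hΔ0).1 (Nat.lt_floor_add_one _)
  have hN2 : (N : ℝ) ≤ (f x₀ - flow) / Δ := Nat.floor_le (div_nonneg hgap hΔ0.le)
  obtain ⟨n, t, x, nv, ng, nr, hruns, h1, h2, h3, h4, h5, h6⟩ :=
    TAGD.tagd_runs hR (p := p) hA hp hΔ hM0 hMl r N 0 x₀ hN1
  have hs4 : 4 ≤ steps := Nat.le_of_dvd hpos hdvd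
  have hps : p.steps = steps := rfl
  rw [hps] at h3 h4 h5 h6
  have hT : ((max (2 * N) 1 * steps : ℕ) : ℝ)
      ≤ max ((f x₀ - flow) / TAGD.bigE rho eps χ c) 1 * steps := by
    push_cast
    have h7 : (2 : ℝ) * N ≤ (f x₀ - flow) / TAGD.bigE rho eps χ c := by
      have h8 : (f x₀ - flow) / TAGD.bigE rho eps χ c = 2 * ((f x₀ - flow) / Δ) := by
        rw [hΔ_def, mul_div_assoc', mul_div_mul_left _ _ (by norm_num)]
      rw [h8]
      linarith
    gcongr
  -- For `N = 0` the gradient count is at most `steps + 2`, which fits in `2 * steps` because the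
  -- final round uses only half of its steps. For `N ≥ 1` the additive terms fit because `4 ≤
  -- steps`.
  have hbounds : t ≤ max (2 * N) 1 * steps ∧ ng ≤ 2 * (max (2 * N) 1 * steps) ∧
      nv ≤ 3 * (max (2 * N) 1 * steps) ∧ nr ≤ 6 * (max (2 * N) 1 * steps) := by
    rcases Nat.eq_zero_or_pos N with h0 | h0
    · rw [h0] at h3 h4 h5 h6 ⊢
      simp only [mul_zero, zero_add, mul_one] at h3 h4 h5 h6
      simp only [mul_zero, zero_le, max_eq_right, one_mul]
      omega
    · rw [max_eq_left (by omega)]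
      have h7 : 4 * N ≤ N * steps := by rw [mul_comm]; exact Nat.mul_le_mul_left N hs4
      have h8 : steps ≤ N * steps := Nat.le_mul_of_pos_left _ h0
      have e1 : steps * (N + 1) = N * steps + steps := by ring
      have e2 : (2 * steps + 1) * N = 2 * (N * steps) + N := by ring
      have e3 : (2 * steps + 3) * N = 2 * (N * steps) + 3 * N := by ring
      have e4 : (4 * steps + 4) * N = 4 * (N * steps) + 4 * N := by ring
      rw [e1] at h3
      rw [e2] at h4
      rw [e3] at h5
      rw [e4] at h6
      rw [mul_assoc 2 N steps]
      omega
  refine ⟨n, t, x, ?_, h1, h2, ?_, ?_, ?_, ?_⟩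
  · have := hruns.output_eq
    rw [zero_add] at this
    exact this
  · exact le_trans (by exact_mod_cast hbounds.1) hT
  · have h7 := hruns.gradQueries_eq
    rw [h7]
    refine le_trans ?_ (mul_le_mul_of_nonneg_left hT (by norm_num))
    exact_mod_cast (show 0 + ng ≤ _ by rw [zero_add]; exact hbounds.2.1)
  · have h7 := hruns.valueQueries_eq
    rw [h7]
    refine le_trans ?_ (mul_le_mul_of_nonneg_left hT (by norm_num))
    exact_mod_cast (show 0 + nv ≤ _ by rw [zero_add]; exact hbounds.2.2.1)
  · have h7 := hruns.retractCalls_eq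
    rw [h7]
    refine le_trans ?_ (mul_le_mul_of_nonneg_left hT (by norm_num))
    exact_mod_cast (show 0 + nr ≤ _ by rw [zero_add]; exact hbounds.2.2.2)
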